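/- A search problem is a relation $R\subseteq\mathcal X\times\{0,1\}^*$ with a set of inputs $\mathcal X\subseteq\{0,1\}^*$. A quantum polynomial-time algorithm is a quantum Turing machine with classical control (a deterministic multi-stack Turing machine that can also move a head over a tape of qubits initialized to $|0\rangle$, apply the gates $H$, $T$ and CNOT there, measure qubits in the computational basis, and take a fresh tape) which, on every input $x\in\{0,1\}^*$, halts within $p(|x|)$ steps with probability $1$, for some polynomial $p$. It is a pseudo-deterministic algorithm for $R$ if there is a function $f$ such that, for every $x\in\mathcal X$, $(x,f(x))\in R$ and the algorithm outputs $f(x)$ on input $x$ with probability at least $2/3$. A decision problem (with promise) is a pair $D$ of disjoint sets $D_{\mathrm{yes}},D_{\mathrm{no}}\subseteq\{0,1\}^*$; a language $L$ is the case $D_{\mathrm{yes}}=L$, $D_{\mathrm{no}}=\{0,1\}^*\setminus L$. It is in $\mathsf{BQP}$ if some quantum polynomial-time algorithm outputs $1$ with probability at least $2/3$ on every $x\in D_{\mathrm{yes}}$ and outputs $0$ with probability at least $2/3$ on every $x\in D_{\mathrm{no}}$. $R$ is $\mathsf P$-reducible to $D$ if there are a deterministic oracle Turing machine and a polynomial $p$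 such that, on every input $x\in\mathcal X$, with an oracle for $D$, the machine only asks queries in $D_{\mathrm{yes}}\cup D_{\mathrm{no}}$ (no restriction if $D$ is a language) and outputs within $p(|x|)$ steps some $y$ with $(x,y)\in R$. **Theorem.** Let $R\subseteq\mathcal X\times\{0,1\}^*$ be a search problem. 1. If $\mathcal X=\{0,1\}^*$, then $R$ has a pseudo-deterministic quantum polynomial-time algorithm if and only if $R$ is $\mathsf P$-reducible to some language in $\mathsf{BQP}$. 2. For arbitrary $\mathcal X$, $R$ has a pseudo-deterministic quantum polynomial-time algorithm if and only if $R$ is $\mathsf P$-reducible to some decision problem in $\mathsf{BQP}$, where decision problems may have a promise. -/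

import Mathlib

noncomputable section

namespace PseudoDet

/-! ### Search problems and decision problems over binary strings -/

/-- A search problem `R ⊆ 𝒳 × {0,1}*` whose set of (valid) inputs is `dom = 𝒳 ⊆ {0,1}*`. -/
structure SearchProblem where
  dom : Set (List Bool)
  rel : Set (List Bool × List Bool)
  fst_mem_dom : ∀ {x y : List Bool}, (x, y) ∈ rel → x ∈ dom

/-- A decision problem, possibly with a promise: the inputs are the strings in `yes ∪ no`. -/
structure DecisionProblem where
  yes : Set (List Bool)
  no : Set (List Bool)
  disjoint : Disjoint yes no

/-- The (total) decision problem of a language. -/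
def DecisionProblem.ofLanguage (L : Set (List Bool)) : DecisionProblem where
  yes := L
  no := Lᶜ
  disjoint := disjoint_compl_right

/-! ### The quantum tape

A two-way infinite tape of qubits, one for each integer. A basis state is given by the finite set
of the cells that hold a `1`. In finitely many steps, starting from the all-zero basis state, only
finite superpositions of these arise. -/

/-- Finite superpositions of the basis states of the tape; they need not be normalized. -/
abbrev QState : Type := Finset ℤ →₀ ℂ

/-- The tape in which every qubit is `|0⟩`. -/
def QState.zero : QState := Finsupp.single ∅ 1

/-- The squared `ℓ²` norm. -/
def QState.normSq (ψ : QState) : ℝ := ψ.sum fun _ a => ‖a‖ ^ 2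

/-- The Hadamard gate on qubit `i`. -/
def hadamard (i : ℤ) : QState →ₗ[ℂ] QState :=
  Finsupp.linearCombination ℂ fun s : Finset ℤ =>
    ((1 / Real.sqrt 2 : ℝ) : ℂ) •
      (Finsupp.single (s.erase i) 1 + Finsupp.single (insert i s) (if i ∈ s then -1 else 1))

/-- The gate `T = diag(1, exp(iπ/4))` on qubit `i`. -/
def tGate (i : ℤ) : QState →ₗ[ℂ] QState :=
  Finsupp.linearCombination ℂ fun s : Finset ℤ =>
    Finsupp.single s (if i ∈ s then Complex.exp (Complex.I * Real.pi / 4) else 1)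

/-- The controlled-not gate with control `i` and target `j` (used for `i ≠ j`). -/
def cnot (i j : ℤ) : QState →ₗ[ℂ] QState :=
  Finsupp.linearCombination ℂ fun s : Finset ℤ =>
    Finsupp.single (if i ∈ s then symmDiff s {j} else s) 1

/-- The projection onto the states in which qubit `i` has the value `b`. -/
def proj (i : ℤ) (b : Bool) (ψ : QState) : QState :=
  ψ.filter fun s => decide (i ∈ s) = b

/-- The instructions for the quantum tape and its head. -/
inductive QInstr
  /-- move the head one cell to the left -/
  | left
  /-- move the head one cell to the right -/
  | right
  /-- Hadamard gate on the scanned qubit -/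
  | had
  /-- `T` gate on the scanned qubit -/
  | tee
  /-- controlled-not, from the scanned qubit to its right neighbour -/
  | cnot
  /-- measure the scanned qubit in the computational basis -/
  | measure
  /-- discard the quantum tape and take a new one, with all qubits `|0⟩` and the head at `0` -/
  | fresh

/-- The effect of an instruction, given the head position and the state: the list of the possible
outcomes, each with the new head position and the new state. States are not renormalized, so that
the squared norm of a state is the probability of the branch of the computation that led to it.
Instructions other than `measure` have the single outcome `false`. -/
def QInstr.exec (h : ℤ) (ψ : QState) : QInstr → List (Bool × ℤ × QState)
  | left => [(false, h - 1, ψ)]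
  | right => [(false, h + 1, ψ)]
  | had => [(false, h, hadamard h ψ)]
  | tee => [(false, h, tGate h ψ)]
  | cnot => [(false, h, PseudoDet.cnot h (h + 1) ψ)]
  | measure => [(false, h, proj h false ψ), (true, h, proj h true ψ)]
  | fresh => [(false, 0, ((Real.sqrt ψ.normSq : ℝ) : ℂ) • QState.zero)]

/-! ### Quantum Turing machines with classical control -/

/-- A quantum Turing machine with classical control: a classical (multi-stack Turing) machine that
also has a quantum tape. At a label `l` with `instr l = some i` it executes the quantum instruction
`i` and goes on to the label `next l b`, where `b` is the outcome; at any other label it takes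
a classical step. -/
structure QuantumTM extends Turing.TM2ComputableAux Bool Bool where
  instr : tm.Λ → Option QInstr
  next : tm.Λ → Bool → tm.Λ

namespace QuantumTM

/-- A configuration on one branch of a computation. -/
structure Cfg (M : QuantumTM) where
  classical : M.tm.Cfg
  head : ℤ
  state : QState

/-- The initial configuration on input `x`. -/
def init (M : QuantumTM) (x : List Bool) : M.Cfg where
  classical := Turing.initList M.tm (x.map M.inputAlphabet.symm)
  head := 0
  state := QState.zero

/-- One step: the list of successors (one, or two for a measurement). Halted configurations
stay as they are. -/
def step (M : QuantumTM) (c : M.Cfg) : List M.Cfg :=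
  match c.classical.l with
  | none => [c]
  | some l =>
    match M.instr l with
    | none => (M.tm.step c.classical).toList.map fun d => { c with classical := d }
    | some i => (i.exec c.head c.state).map fun o =>
        { classical := { c.classical with l := some (M.next l o.1) }
          head := o.2.1
          state := o.2.2 }

/-- All branches of the computation on input `x` after `t` steps. -/
def run (M : QuantumTM) (x : List Bool) : ℕ → List M.Cfg
  | 0 => [M.init x]
  | t + 1 => (M.run x t).flatMap M.step

/-- The output of a halted configuration: the contents of the output stack. -/
def output (M : QuantumTM) (c : M.Cfg) : Option (List Bool) :=
  if c.classical.l.isNone then some ((c.classical.stk M.tm.k₁).map M.outputAlphabet) else none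

/-- The probability that `M`, on input `x`, has halted after `t` steps with output `y`. -/
def outputProb (M : QuantumTM) (x : List Bool) (t : ℕ) (y : List Bool) : ℝ :=
  ((M.run x t).map fun c => if M.output c = some y then c.state.normSq else 0).sum

/-- On every input `x`, every branch of the computation that has non-zero probability halts within
`p(|x|)` steps. -/
def RunsInTime (M : QuantumTM) (p : Polynomial ℕ) : Prop :=
  ∀ x : List Bool, ∀ c ∈ M.run x (p.eval x.length), c.state.normSq ≠ 0 → c.classical.l = none

end QuantumTM

/-- `R` has a pseudo-deterministic quantum polynomial-time algorithm. -/
def SearchProblem.HasPseudoDetQuantumPolyTime (R : SearchProblem) : Prop :=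
  ∃ (M : QuantumTM) (p : Polynomial ℕ), M.RunsInTime p ∧
    ∃ f : List Bool → List Bool, ∀ x ∈ R.dom,
      (x, f x) ∈ R.rel ∧ 2 / 3 ≤ M.outputProb x (p.eval x.length) (f x)

/-- `D` is in BQP: a quantum polynomial-time algorithm outputs the correct one of the answers `1`
and `0` with probability at least `2/3`. -/
def DecisionProblem.InBQP (D : DecisionProblem) : Prop :=
  ∃ (M : QuantumTM) (p : Polynomial ℕ), M.RunsInTime p ∧
    (∀ x ∈ D.yes, 2 / 3 ≤ M.outputProb x (p.eval x.length) [true]) ∧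
    (∀ x ∈ D.no, 2 / 3 ≤ M.outputProb x (p.eval x.length) [false])

/-! ### Deterministic polynomial-time Turing reductions -/

/-- A deterministic oracle Turing machine. At the label `query` it asks the oracle about the string
on the query stack; this stack is then emptied, and the machine goes on to the label `ansYes` or
`ansNo`. -/
structure OracleTM extends Turing.TM2ComputableAux Bool Bool where
  queryStack : tm.K
  queryAlphabet : tm.Γ queryStack ≃ Bool
  query : tm.Λ
  ansYes : tm.Λ
  ansNo : tm.Λ

namespace OracleTM

/-- The contents of the query stack. -/
def queryString (M : OracleTM) (c : M.tm.Cfg) : List Bool :=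
  (c.stk M.queryStack).map M.queryAlphabet

open Classical in
/-- One step with oracle `O`. Halted configurations stay as they are. -/
def step (M : OracleTM) (O : Set (List Bool)) (c : M.tm.Cfg) : M.tm.Cfg :=
  if c.l = some M.query then
    { l := some (if M.queryString c ∈ O then M.ansYes else M.ansNo)
      var := c.var
      stk := Function.update c.stk M.queryStack [] }
  else (M.tm.step c).getD c

/-- The configuration after `t` steps on input `x` with oracle `O`. -/
def run (M : OracleTM) (O : Set (List Bool)) (x : List Bool) (t : ℕ) : M.tm.Cfg :=
  (M.step O)^[t] (Turing.initList M.tm (x.map M.inputAlphabet.symm))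

/-- The output of a halted configuration: the contents of the output stack. -/
def output (M : OracleTM) (c : M.tm.Cfg) : Option (List Bool) :=
  if c.l.isNone then some ((c.stk M.tm.k₁).map M.outputAlphabet) else none

end OracleTM

/-- `R` is reducible to `D` by a deterministic polynomial-time Turing reduction: some deterministic
oracle machine, run on a valid input `x` of `R` with an oracle for `D`, asks the oracle only about
inputs of `D` (no condition if `D` is a language) and outputs a solution for `x` within `p(|x|)`
steps. -/
def SearchProblem.PReducible (R : SearchProblem) (D : DecisionProblem) : Prop :=
  ∃ (M : OracleTM) (p : Polynomial ℕ), ∀ x ∈ R.dom,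
    (∀ t : ℕ, (M.run D.yes x t).l = some M.query →
      M.queryString (M.run D.yes x t) ∈ D.yes ∪ D.no) ∧
    ∃ y : List Bool, M.output (M.run D.yes x (p.eval x.length)) = some y ∧ (x, y) ∈ R.rel

end PseudoDet

end

noncomputable section

open Turing

namespace PseudoDet

/-! ### Norms of states -/

/-! Both parts rest on the same two constructions; the first part only needs the extra remark that a
function defined on all strings leads to a problem without promise.

From an algorithm to a reduction. Let `M` output `f x` with probability at least 2/3. The string
`1^i 0 x` encodes a question about `f x`: for even `i`, whether there is a symbol at position `i /
2`; for odd `i`, which one. `bitMachine` strips the prefix, runs `M` on `x` and reads the answer off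
the output, so it is right at least as often as `M` (`inBQP_bitProblem`). The deterministic
`BitCollector` asks these questions in turn until the string ends. This takes polynomial time
because an output of positive probability is no longer than the input plus the number of symbols
pushed. Malformed queries are no-instances, so if every input is valid then every string is an
instance (`bitProblem_univ`).

From a reduction to an algorithm. With a correct oracle the oracle machine is deterministic, so the
solution it finds is a function `f` of the input. The quantum machine simulates it and answers each
query by a majority vote among `R` independent runs of the machine `N` for the oracle problem. By
Chebyshev's inequality (`le_voteValue`) the majority is wrong with probability at most `9 / R`.
Hence `τ` steps all go right with probability at least `(1 - 9 / R) ^ τ ≥ 1 - 9 * τ / R`, which is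
at least 2/3 once `R ≥ 27 * τ`. A unary clock of length `(n + 2) ^ k` stops the simulation, so that
it halts in polynomial time also on invalid inputs and after wrong answers (`yields_simulation`).

Probabilities are squared norms of states that are never renormalized. `Yields` combines halting
with a lower bound on the weight of an output, and is proved backwards from the end of a program.
Gates preserve norms, so weight is conserved. A run of `N` on a fresh tape inside a branch of weight
`w` is the run from the start scaled by `√w` (`runFrom_scale`); this is what makes repeated runs
independent. -/

theorem QState.normSq_nonneg (ψ : QState) : 0 ≤ ψ.normSq :=
  Finsupp.sum_nonneg fun _ _ => by positivity

/-- The support is finite. The reindexing by `e` is there for the bit flips that pair up basis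
states under a Hadamard gate. -/
theorem QState.summable_normSq (ψ : QState) (e : Finset ℤ ≃ Finset ℤ) :
    Summable fun s => ‖ψ (e s)‖ ^ 2 := by
  refine e.summable_iff (f := fun s => ‖ψ s‖ ^ 2) |>.mpr ?_
  refine summable_of_ne_finset_zero (s := ψ.support) fun s hs => ?_
  simp [Finsupp.notMem_support_iff.mp hs]

theorem QState.normSq_eq_tsum (ψ : QState) : ψ.normSq = ∑' s, ‖ψ s‖ ^ 2 := by
  rw [tsum_eq_sum (s := ψ.support)]
  · rfl
  · intro s hs
    simp [Finsupp.notMem_support_iff.mp hs]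

theorem QState.normSq_smul (a : ℂ) (ψ : QState) : (a • ψ).normSq = ‖a‖ ^ 2 * ψ.normSq := by
  simp only [normSq_eq_tsum, ← tsum_mul_left]
  simp [mul_pow]

/-- Flipping the bit of cell `i` of a basis state. -/
def flipBit (i : ℤ) : Finset ℤ ≃ Finset ℤ :=
  (symmDiff_right_involutive {i}).toPerm

theorem flipBit_apply (i : ℤ) (s : Finset ℤ) :
    flipBit i s = if i ∈ s then s.erase i else insert i s := by
  ext j
  by_cases h : i ∈ s <;> by_cases hj : j = i <;>
    simp_all [flipBit, Function.Involutive.toPerm, Finset.mem_symmDiff]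

/-- Only the basis state `s` and its flip at `i` contribute to the amplitude at `s`; linearity
reduces the claim to basis states. -/
theorem hadamard_apply (i : ℤ) (ψ : QState) (s : Finset ℤ) :
    hadamard i ψ s = ((1 / Real.sqrt 2 : ℝ) : ℂ) *
      (if i ∈ s then ψ (flipBit i s) - ψ s else ψ s + ψ (flipBit i s)) := by
  induction ψ using Finsupp.induction_linear with
  | zero => simp
  | add f g hf hg =>
    rw [map_add, Finsupp.add_apply, hf, hg]
    split_ifs <;> simp only [Finsupp.add_apply] <;> ring
  | single t a =>
    have h1 : t.erase i = s ↔ i ∉ s ∧ (t = s ∨ t = insert i s) := by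
      constructor
      · rintro rfl
        refine ⟨by simp, ?_⟩
        by_cases h : i ∈ t
        · right; simp [h]
        · left; simp [h]
      · rintro ⟨h, rfl | rfl⟩ <;> simp [h]
    have h2 : insert i t = s ↔ i ∈ s ∧ (t = s ∨ t = s.erase i) := by
      constructor
      · rintro rfl
        refine ⟨by simp, ?_⟩
        by_cases h : i ∈ t
        · left; simp [h]
        · right; simp [h]
      · rintro ⟨h, rfl | rfl⟩ <;> simp [h]
    simp only [hadamard, Finsupp.linearCombination_single, Finsupp.smul_apply, Finsupp.add_apply,
      smul_eq_mul, Finsupp.single_apply, flipBit_apply, h1, h2]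
    by_cases hs : i ∈ s
    · by_cases e1 : t = s
      · subst e1
        have : ¬ t = t.erase i := fun h => by rw [h] at hs; simp at hs
        simp [hs, this]; ring
      · by_cases e2 : t = s.erase i
        · simp [hs, e2, mul_comm]
        · simp [hs, e1, e2]
    · by_cases e1 : t = s
      · subst e1
        have : ¬ t = insert i t := fun h => hs (by rw [h]; simp)
        simp [hs, this]; ring
      · by_cases e2 : t = insert i s
        · simp [hs, e2, mul_comm]
        · simp [hs, e1, e2]

theorem tGate_apply (i : ℤ) (ψ : QState) (s : Finset ℤ) :
    tGate i ψ s = (if i ∈ s then Complex.exp (Complex.I * Real.pi / 4) else 1) * ψ s := by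
  induction ψ using Finsupp.induction_linear with
  | zero => simp
  | add f g hf hg => rw [map_add, Finsupp.add_apply, hf, hg, Finsupp.add_apply]; ring
  | single t a =>
    by_cases h : t = s
    · subst h; simp [tGate, mul_comm]
    · simp [tGate, h]

/-- The action of a controlled-not gate on the basis states. -/
def cnotPerm {i j : ℤ} (h : i ≠ j) : Finset ℤ ≃ Finset ℤ :=
  Function.Involutive.toPerm (fun s => if i ∈ s then symmDiff s {j} else s) fun s => by
    by_cases hs : i ∈ s
    · have : i ∈ symmDiff s {j} := by simp [Finset.mem_symmDiff, hs, h]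
      simp [hs, this]
    · simp [hs]

theorem cnot_apply {i j : ℤ} (h : i ≠ j) (ψ : QState) (s : Finset ℤ) :
    cnot i j ψ s = ψ (cnotPerm h s) := by
  induction ψ using Finsupp.induction_linear with
  | zero => simp
  | add f g hf hg => rw [map_add, Finsupp.add_apply, hf, hg, Finsupp.add_apply]
  | single t a =>
    have : cnot i j (Finsupp.single t a) = Finsupp.single (cnotPerm h t) a := by
      simp [cnot, cnotPerm, Function.Involutive.toPerm]
    rw [this, Finsupp.single_apply, Finsupp.single_apply]
    have : cnotPerm h t = s ↔ t = cnotPerm h s := by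
      rw [← Equiv.eq_symm_apply]; rfl
    simp only [this]

/-- The gate acts on each pair of a basis state and its flip by a normalized sum and difference, so
the parallelogram law applies pair by pair. -/
theorem normSq_hadamard (i : ℤ) (ψ : QState) : (hadamard i ψ).normSq = ψ.normSq := by
  -- Summing over all `s` counts every pair twice, whence the factor 2; this avoids choosing a
  -- representative of each pair.
  have key : ∀ φ : QState, 2 * φ.normSq = ∑' s, (‖φ s‖ ^ 2 + ‖φ (flipBit i s)‖ ^ 2) := by
    intro φ
    rw [Summable.tsum_add (by exact φ.summable_normSq (Equiv.refl _)) (φ.summable_normSq (flipBit i)),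
      (flipBit i).tsum_eq (fun s => ‖φ s‖ ^ 2), φ.normSq_eq_tsum]
    simp only [two_mul]
  have hn : ‖((1 / Real.sqrt 2 : ℝ) : ℂ)‖ ^ 2 = 1 / 2 := by
    rw [Complex.norm_real, Real.norm_eq_abs, sq_abs, div_pow, Real.sq_sqrt (by norm_num)]
    norm_num
  have par : ∀ a b : ℂ, ‖a + b‖ ^ 2 + ‖a - b‖ ^ 2 = 2 * (‖a‖ ^ 2 + ‖b‖ ^ 2) := fun a b => by
    have := parallelogram_law_with_norm ℝ a b
    nlinarith
  have : 2 * (hadamard i ψ).normSq = 2 * ψ.normSq := by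
    rw [key, key]
    refine tsum_congr fun s => ?_
    have hff : flipBit i (flipBit i s) = s := (flipBit i).left_inv s
    have hmem : i ∈ flipBit i s ↔ i ∉ s := by
      rw [flipBit_apply]; split_ifs with h <;> simp [h]
    rw [hadamard_apply, hadamard_apply, hff]
    simp only [hmem, norm_mul, mul_pow, hn]
    by_cases h : i ∈ s
    · have := par (ψ (flipBit i s)) (ψ s)
      simp only [h, not_true, if_true, if_false]
      linarith
    · have := par (ψ s) (ψ (flipBit i s))
      simp only [h, not_false_eq_true, if_true, if_false]
      linarith
  linarith

theorem normSq_tGate (i : ℤ) (ψ : QState) : (tGate i ψ).normSq = ψ.normSq := by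
  rw [QState.normSq_eq_tsum, QState.normSq_eq_tsum]
  refine tsum_congr fun s => ?_
  rw [tGate_apply]
  split_ifs
  · have : Complex.I * Real.pi / 4 = ((Real.pi / 4 : ℝ) : ℂ) * Complex.I := by push_cast; ring
    rw [norm_mul, this, Complex.norm_exp_ofReal_mul_I, one_mul]
  · rw [one_mul]

theorem normSq_cnot {i j : ℤ} (h : i ≠ j) (ψ : QState) : (cnot i j ψ).normSq = ψ.normSq := by
  rw [QState.normSq_eq_tsum, QState.normSq_eq_tsum, ← (cnotPerm h).tsum_eq fun s => ‖ψ s‖ ^ 2]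
  exact tsum_congr fun s => by rw [cnot_apply h]

theorem normSq_proj_add (i : ℤ) (ψ : QState) :
    (proj i false ψ).normSq + (proj i true ψ).normSq = ψ.normSq := by
  simp only [QState.normSq_eq_tsum]
  rw [← Summable.tsum_add (by exact (proj i false ψ).summable_normSq (Equiv.refl _))
    (by exact (proj i true ψ).summable_normSq (Equiv.refl _))]
  refine tsum_congr fun s => ?_
  by_cases h : i ∈ s <;> simp [proj, h]

theorem normSq_zeroState : QState.zero.normSq = 1 := by
  simp [QState.zero, QState.normSq]

theorem normSq_sqrt_smul_zero {w : ℝ} (hw : 0 ≤ w) :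
    (((Real.sqrt w : ℝ) : ℂ) • QState.zero).normSq = w := by
  rw [QState.normSq_smul, normSq_zeroState, Complex.norm_real, Real.norm_eq_abs, sq_abs,
    Real.sq_sqrt hw, mul_one]

/-- An instruction preserves the total squared norm. -/
theorem QInstr.sum_normSq_exec (i : QInstr) (h : ℤ) (ψ : QState) :
    ((i.exec h ψ).map fun o => o.2.2.normSq).sum = ψ.normSq := by
  cases i <;> simp [QInstr.exec, normSq_hadamard, normSq_tGate, normSq_cnot, normSq_proj_add, -Complex.coe_smul]
  -- What remains is `fresh`, which stores the weight of the branch in the amplitude of the new zero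
  -- state.
  rw [normSq_sqrt_smul_zero ψ.normSq_nonneg]

/-- Instructions commute with scaling by a nonnegative real. -/
theorem QInstr.exec_smul (i : QInstr) (h : ℤ) (ψ : QState) {a : ℝ} (ha : 0 ≤ a) :
    i.exec h ((a : ℂ) • ψ) = (i.exec h ψ).map fun o => (o.1, o.2.1, (a : ℂ) • o.2.2) := by
  cases i <;> simp [QInstr.exec, proj, Finsupp.filter_smul, -Complex.coe_smul]
  rw [QState.normSq_smul, Complex.norm_real, Real.norm_eq_abs, sq_abs,
    Real.sqrt_mul (sq_nonneg a), Real.sqrt_sq ha, smul_smul]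
  push_cast
  rfl

/-! ### Branches of a quantum computation -/

theorem sum_map_flatMap {α β : Type*} (l : List α) (f : α → List β) (g : β → ℝ) :
    ((l.flatMap f).map g).sum = (l.map fun a => ((f a).map g).sum).sum := by
  induction l with
  | nil => rfl
  | cons a l ih => simp [List.flatMap_cons, ih]

namespace QuantumTM

variable {M : QuantumTM}

/-- All branches of the computation from `c` after `t` steps. -/
def runFrom (M : QuantumTM) (c : M.Cfg) : ℕ → List M.Cfg
  | 0 => [c]
  | t + 1 => (M.runFrom c t).flatMap M.step

theorem run_eq_runFrom (M : QuantumTM) (x : List Bool) (t : ℕ) :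
    M.run x t = M.runFrom (M.init x) t := by
  induction t with
  | zero => rfl
  | succ t ih => rw [run, runFrom, ih]

/-- `runFrom` appends steps at the end, while backward reasoning about programs peels off the first
one. -/
theorem runFrom_succ (c : M.Cfg) (t : ℕ) :
    M.runFrom c (t + 1) = (M.step c).flatMap fun d => M.runFrom d t := by
  induction t with
  | zero => simp [runFrom]
  | succ t ih =>
    rw [runFrom, ih, List.flatMap_assoc]
    rfl

theorem step_of_halted {c : M.Cfg} (h : c.classical.l = none) : M.step c = [c] := by
  simp [step, h]

theorem runFrom_of_halted {c : M.Cfg} (h : c.classical.l = none) (t : ℕ) :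
    M.runFrom c t = [c] := by
  induction t with
  | zero => rfl
  | succ t ih => rw [runFrom, ih, List.flatMap_singleton, step_of_halted h]

theorem step_classical {l : M.tm.Λ} (hl : M.instr l = none) (v : M.tm.σ)
    (S : ∀ k, List (M.tm.Γ k)) (h : ℤ) (ψ : QState) :
    M.step ⟨⟨some l, v, S⟩, h, ψ⟩ = [⟨TM2.stepAux (M.tm.m l) v S, h, ψ⟩] := by
  simp only [step, hl]
  rfl

theorem step_quantum {l : M.tm.Λ} {i : QInstr} (hl : M.instr l = some i) (v : M.tm.σ)
    (S : ∀ k, List (M.tm.Γ k)) (h : ℤ) (ψ : QState) :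
    M.step ⟨⟨some l, v, S⟩, h, ψ⟩ =
      (i.exec h ψ).map fun o => ⟨⟨some (M.next l o.1), v, S⟩, o.2.1, o.2.2⟩ := by
  simp [step, hl]

theorem sum_normSq_step (c : M.Cfg) :
    ((M.step c).map fun d => d.state.normSq).sum = c.state.normSq := by
  obtain ⟨⟨l, v, S⟩, h, ψ⟩ := c
  cases l with
  | none => rw [step_of_halted rfl]; simp
  | some l =>
    cases hl : M.instr l with
    | none => rw [step_classical hl]; simp
    | some i =>
      rw [step_quantum hl, List.map_map]
      exact i.sum_normSq_exec h ψ

theorem sum_normSq_runFrom (c : M.Cfg) (t : ℕ) :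
    ((M.runFrom c t).map fun d => d.state.normSq).sum = c.state.normSq := by
  induction t with
  | zero => simp [runFrom]
  | succ t ih =>
    rw [runFrom, sum_map_flatMap]
    simp only [sum_normSq_step, ih]

/-- Weight is conserved and nonnegative, so a branch without weight has only descendants without
weight. Their halting behaviour is therefore irrelevant. -/
theorem normSq_eq_zero_of_mem_runFrom {c d : M.Cfg} {t : ℕ} (hc : c.state.normSq = 0)
    (hd : d ∈ M.runFrom c t) : d.state.normSq = 0 := by
  have h := sum_normSq_runFrom c t
  rw [hc] at h
  refine le_antisymm (h ▸ List.single_le_sum ?_ _ (List.mem_map_of_mem hd)) d.state.normSq_nonneg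
  intro a ha
  obtain ⟨e, -, rfl⟩ := List.mem_map.mp ha
  exact e.state.normSq_nonneg

/-- The probability of a branch, if it has halted with output `y`. -/
def weight (M : QuantumTM) (y : List Bool) (c : M.Cfg) : ℝ :=
  if M.output c = some y then c.state.normSq else 0

theorem weight_nonneg (y : List Bool) (c : M.Cfg) : 0 ≤ M.weight y c := by
  unfold weight
  split_ifs
  exacts [c.state.normSq_nonneg, le_rfl]

theorem weight_le (y : List Bool) (c : M.Cfg) : M.weight y c ≤ c.state.normSq := by
  unfold weight
  split_ifs
  exacts [le_rfl, c.state.normSq_nonneg]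

theorem weight_eq_zero {c : M.Cfg} (h : c.state.normSq = 0) (y : List Bool) :
    M.weight y c = 0 := by
  simp [weight, h]

theorem halted_of_output {c : M.Cfg} {y : List Bool} (h : M.output c = some y) :
    c.classical.l = none := by
  unfold output at h
  split_ifs at h with hl
  exact Option.isNone_iff_eq_none.mp hl

/-- Every branch from `c` of non-zero probability halts within `t` steps, and the branches with
output `y` have total probability at least `v`. -/
def Yields (M : QuantumTM) (y : List Bool) (t : ℕ) (c : M.Cfg) (v : ℝ) : Prop :=
  (∀ d ∈ M.runFrom c t, d.state.normSq ≠ 0 → d.classical.l = none) ∧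
    v ≤ ((M.runFrom c t).map (M.weight y)).sum

variable {y : List Bool} {t t' : ℕ} {c : M.Cfg} {v v' : ℝ}

theorem yields_of_halted (h : c.classical.l = none) (t : ℕ) :
    M.Yields y t c (M.weight y c) := by
  simp [Yields, runFrom_of_halted h, h]

theorem yields_of_normSq_eq_zero (h : c.state.normSq = 0) (t : ℕ) : M.Yields y t c 0 := by
  refine ⟨fun d hd hn => (hn (normSq_eq_zero_of_mem_runFrom h hd)).elim, ?_⟩
  refine List.sum_nonneg fun a ha => ?_
  obtain ⟨d, -, rfl⟩ := List.mem_map.mp ha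
  exact weight_nonneg y d

theorem Yields.mono_value (h : M.Yields y t c v) (hv : v' ≤ v) : M.Yields y t c v' :=
  ⟨h.1, hv.trans h.2⟩

/-- After `t` steps a branch either has halted and stays put, or has weight zero, and then its
successors contribute nothing either. -/
theorem Yields.succ (h : M.Yields y t c v) : M.Yields y (t + 1) c v := by
  have key : ∀ d ∈ M.runFrom c t, M.step d = [d] ∨ d.state.normSq = 0 := fun d hd => by
    by_cases hn : d.state.normSq = 0
    · exact Or.inr hn
    · exact Or.inl (step_of_halted (h.1 d hd hn))
  have hz : ∀ d : M.Cfg, d.state.normSq = 0 → ∀ e ∈ M.step d, e.state.normSq = 0 :=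
    fun d hd e he => normSq_eq_zero_of_mem_runFrom (t := 1) hd (by simpa [runFrom] using he)
  constructor
  · intro e he hn
    rw [runFrom, List.mem_flatMap] at he
    obtain ⟨d, hd, he⟩ := he
    rcases key d hd with hs | hs
    · rw [hs, List.mem_singleton] at he
      subst he
      exact h.1 e hd hn
    · exact (hn (hz d hs e he)).elim
  · refine h.2.trans (le_of_eq ?_)
    rw [runFrom, sum_map_flatMap]
    refine congrArg List.sum (List.map_congr_left fun d hd => ?_)
    rcases key d hd with hs | hs
    · simp [hs]
    · rw [weight_eq_zero hs]
      symm
      refine List.sum_eq_zero fun a ha => ?_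
      obtain ⟨e, he, rfl⟩ := List.mem_map.mp ha
      exact weight_eq_zero (hz d hs e he) y

theorem Yields.mono_time (h : M.Yields y t c v) (ht : t ≤ t') : M.Yields y t' c v := by
  induction ht with
  | refl => exact h
  | step _ ih => exact ih.succ

theorem Yields.mono (h : M.Yields y t c v) (ht : t ≤ t') (hv : v' ≤ v) : M.Yields y t' c v' :=
  (h.mono_time ht).mono_value hv

/-- The backward rule: values of the successors add up to a value of the configuration. -/
theorem yields_of_step (f : M.Cfg → ℝ) (h : ∀ d ∈ M.step c, M.Yields y t d (f d)) :
    M.Yields y (t + 1) c ((M.step c).map f).sum := by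
  constructor
  · intro e he
    rw [runFrom_succ, List.mem_flatMap] at he
    obtain ⟨d, hd, he⟩ := he
    exact (h d hd).1 e he
  · rw [runFrom_succ, sum_map_flatMap]
    exact List.sum_le_sum fun d hd => (h d hd).2

theorem yields_classical {l : M.tm.Λ} (hl : M.instr l = none) {u : M.tm.σ}
    {S : ∀ k, List (M.tm.Γ k)} {h : ℤ} {ψ : QState}
    (H : M.Yields y t ⟨TM2.stepAux (M.tm.m l) u S, h, ψ⟩ v) :
    M.Yields y (t + 1) ⟨⟨some l, u, S⟩, h, ψ⟩ v := by
  have := yields_of_step (M := M) (y := y) (t := t) (c := ⟨⟨some l, u, S⟩, h, ψ⟩) (fun _ => v)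
    (by rw [step_classical hl]; simpa using H)
  rw [step_classical hl] at this
  simpa using this

/-- Simulation: if the machine `M` follows the machine `N` until `N` halts, then what holds of `M`
after that holds, summed over the branches of `N`, before. -/
theorem yields_of_simulation {N : QuantumTM} (emb : N.Cfg → M.Cfg)
    (hstep : ∀ c, c.classical.l ≠ none → M.step (emb c) = (N.step c).map emb)
    (hstate : ∀ c, (emb c).state = c.state) (val : N.Cfg → ℝ)
    (hval : ∀ c, c.state.normSq = 0 → val c = 0) (t' t : ℕ) (c : N.Cfg)
    (hhalt : ∀ d ∈ N.runFrom c t, d.state.normSq ≠ 0 → d.classical.l = none)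
    (hgood : ∀ d ∈ N.runFrom c t, d.classical.l = none → M.Yields y t' (emb d) (val d)) :
    M.Yields y (t + t') (emb c) ((N.runFrom c t).map val).sum := by
  induction t generalizing c with
  | zero =>
    have hc : c ∈ N.runFrom c 0 := by simp [runFrom]
    have : ((N.runFrom c 0).map val).sum = val c := by simp [runFrom]
    rw [this, zero_add]
    -- `hhalt` says nothing about branches without weight; for these `hval` makes the claimed value
    -- zero.
    by_cases h0 : c.state.normSq = 0
    · rw [hval c h0]
      exact yields_of_normSq_eq_zero (by rw [hstate, h0]) _
    · exact hgood c hc (hhalt c hc h0)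
  | succ t ih =>
    -- A halted `N` stands still while `M` moves on, so the correspondence of steps is used only
    -- before halting.
    by_cases hl : c.classical.l = none
    · rw [runFrom_of_halted hl]
      have := hgood c (by rw [runFrom_of_halted hl]; simp) hl
      simpa using this.mono_time (by omega : t' ≤ t + 1 + t')
    · have hsub : ∀ d ∈ N.step c, ∀ e ∈ N.runFrom d t, e ∈ N.runFrom c (t + 1) :=
        fun d hd e he => by
          rw [runFrom_succ, List.mem_flatMap]
          exact ⟨d, hd, he⟩
      have key : ∀ d ∈ N.step c, M.Yields y (t + t') (emb d) ((N.runFrom d t).map val).sum :=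
        fun d hd => ih d (fun e he => hhalt e (hsub d hd e he))
          (fun e he => hgood e (hsub d hd e he))
      rw [runFrom_succ, sum_map_flatMap, show t + 1 + t' = t + t' + 1 by omega]
      constructor
      · intro e he
        rw [runFrom_succ, hstep c hl, List.mem_flatMap] at he
        obtain ⟨d', hd', he⟩ := he
        obtain ⟨d, hd, rfl⟩ := List.mem_map.mp hd'
        exact (key d hd).1 e he
      · rw [runFrom_succ, hstep c hl, sum_map_flatMap, List.map_map]
        exact List.sum_le_sum fun d hd => (key d hd).2

/-! ### Scaling -/

/-- Scale the state of a configuration. -/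
def Cfg.scale (a : ℝ) (c : M.Cfg) : M.Cfg :=
  { c with state := (a : ℂ) • c.state }

theorem step_scale {a : ℝ} (ha : 0 ≤ a) (c : M.Cfg) :
    M.step (c.scale a) = (M.step c).map (Cfg.scale a) := by
  obtain ⟨⟨l, v, S⟩, h, ψ⟩ := c
  cases l with
  | none => rw [step_of_halted rfl, step_of_halted rfl]; rfl
  | some l =>
    cases hl : M.instr l with
    | none =>
      rw [step_classical hl, Cfg.scale, step_classical hl]
      rfl
    | some i =>
      rw [step_quantum hl, Cfg.scale, step_quantum hl, QInstr.exec_smul _ _ _ ha, List.map_map,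
        List.map_map]
      rfl

/-- All instructions commute with scaling, including `fresh`, whose amplitude is the norm of the
state. A run of a subroutine within a branch is thus a scaled copy of a run on its own. -/
theorem runFrom_scale {a : ℝ} (ha : 0 ≤ a) (c : M.Cfg) (t : ℕ) :
    M.runFrom (c.scale a) t = (M.runFrom c t).map (Cfg.scale a) := by
  induction t with
  | zero => rfl
  | succ t ih =>
    rw [runFrom, ih, runFrom, List.map_flatMap, List.flatMap_map]
    exact congrArg (List.flatMap · _) (funext fun d => step_scale ha d)

theorem normSq_scale (a : ℝ) (c : M.Cfg) :
    (c.scale a).state.normSq = a ^ 2 * c.state.normSq := by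
  rw [Cfg.scale, QState.normSq_smul, Complex.norm_real, Real.norm_eq_abs, sq_abs]

theorem weight_scale (a : ℝ) (c : M.Cfg) : M.weight y (c.scale a) = a ^ 2 * M.weight y c := by
  unfold weight
  rw [normSq_scale, mul_ite, mul_zero]
  rfl

end QuantumTM

/-! ### Stack machines: lengths of stacks and embedding of programs -/

section Stmt

variable {K K' : Type} [DecidableEq K] [DecidableEq K'] {Γ : K → Type} {Γ' : K' → Type}
  {Λ Λ' σ σ' : Type}

/-- A bound for the number of symbols that a statement pushes. -/
def pushes : TM2.Stmt Γ Λ σ → ℕ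
  | .push _ _ q => pushes q + 1
  | .peek _ _ q => pushes q
  | .pop _ _ q => pushes q
  | .load _ q => pushes q
  | .branch _ q₁ q₂ => pushes q₁ + pushes q₂
  | .goto _ => 0
  | .halt => 0

/-- Both arms of a branch are counted in `pushes`, so the bound does not depend on the path taken.
-/
theorem length_stepAux_le (q : TM2.Stmt Γ Λ σ) (v : σ) (S : ∀ k, List (Γ k)) (k : K) :
    ((TM2.stepAux q v S).stk k).length ≤ (S k).length + pushes q := by
  induction q generalizing v S with
  | push k' f q ih =>
    refine (ih _ _).trans ?_
    by_cases h : k = k'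
    · subst h
      rw [Function.update_self, List.length_cons, pushes]
      omega
    · simp [h, pushes]
  | peek k' f q ih => exact ih _ _
  | pop k' f q ih =>
    refine (ih _ _).trans ?_
    by_cases h : k = k'
    · subst h; simp [pushes]
    · simp [h, pushes]
  | load a q ih => exact ih _ _
  | branch p q₁ q₂ ih₁ ih₂ =>
    rw [TM2.stepAux, pushes]
    cases p v
    · exact (ih₂ _ _).trans (by omega)
    · exact (ih₁ _ _).trans (by omega)
  | goto l => simp [pushes]
  | halt => simp [pushes]

/-- Embed a statement into a machine with more stacks, labels and variables; `H` is executed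
instead of `halt`. -/
def embedStmt (ι : K → K') (e : ∀ k, Γ k → Γ' (ι k)) (ei : ∀ k, Γ' (ι k) → Γ k) (lab : Λ → Λ')
    (get : σ' → σ) (set : σ → σ' → σ') (H : TM2.Stmt Γ' Λ' σ') :
    TM2.Stmt Γ Λ σ → TM2.Stmt Γ' Λ' σ'
  | .push k f q => .push (ι k) (fun v => e k (f (get v))) (embedStmt ι e ei lab get set H q)
  | .peek k f q => .peek (ι k) (fun v o => set (f (get v) (o.map (ei k))) v)
      (embedStmt ι e ei lab get set H q)
  | .pop k f q => .pop (ι k) (fun v o => set (f (get v) (o.map (ei k))) v)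
      (embedStmt ι e ei lab get set H q)
  | .load a q => .load (fun v => set (a (get v)) v) (embedStmt ι e ei lab get set H q)
  | .branch p q₁ q₂ => .branch (fun v => p (get v)) (embedStmt ι e ei lab get set H q₁)
      (embedStmt ι e ei lab get set H q₂)
  | .goto l => .goto fun v => lab (l (get v))
  | .halt => H

/-- `put` and `merge` place the memory of the small machine inside that of the large one. The
hypotheses say that reading and writing commute with this; then the two runs agree until `halt`,
where `H` takes over. -/
theorem stepAux_embedStmt {ι : K → K'} {e : ∀ k, Γ k → Γ' (ι k)} {ei : ∀ k, Γ' (ι k) → Γ k}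
    {lab : Λ → Λ'} {get : σ' → σ} {set : σ → σ' → σ'} {H : TM2.Stmt Γ' Λ' σ'}
    (put : σ → σ') (merge : (∀ k, List (Γ k)) → ∀ k, List (Γ' k))
    (he : ∀ k a, ei k (e k a) = a) (hget : ∀ v, get (put v) = v)
    (hset : ∀ v w, set w (put v) = put w) (hmerge : ∀ S k, merge S (ι k) = (S k).map (e k))
    (hupdate : ∀ S k l, Function.update (merge S) (ι k) (l.map (e k)) =
      merge (Function.update S k l))
    (q : TM2.Stmt Γ Λ σ) (v : σ) (S : ∀ k, List (Γ k)) :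
    TM2.stepAux (embedStmt ι e ei lab get set H q) (put v) (merge S) =
      match TM2.stepAux q v S with
      | ⟨some l, w, T⟩ => ⟨some (lab l), put w, merge T⟩
      | ⟨none, w, T⟩ => TM2.stepAux H (put w) (merge T) := by
  have hhead : ∀ S k, ((merge S (ι k)).head?).map (ei k) = (S k).head? := fun S k => by
    rw [hmerge]; cases S k <;> simp [he]
  induction q generalizing v S with
  | push k f q ih =>
    rw [embedStmt, TM2.stepAux, TM2.stepAux, hmerge, hget, ← List.map_cons, hupdate, ih]
  | peek k f q ih => rw [embedStmt, TM2.stepAux, TM2.stepAux, hget, hset, hhead, ih]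
  | pop k f q ih =>
    rw [embedStmt, TM2.stepAux, TM2.stepAux, hget, hset, hhead, hmerge, ← List.map_tail,
      hupdate, ih]
  | load a q ih => rw [embedStmt, TM2.stepAux, TM2.stepAux, hget, hset, ih]
  | branch p q₁ q₂ ih₁ ih₂ =>
    rw [embedStmt, TM2.stepAux, TM2.stepAux, hget]
    cases p v
    · exact ih₂ v S
    · exact ih₁ v S
  | goto l => simp only [embedStmt, TM2.stepAux, hget]
  | halt => simp only [embedStmt, TM2.stepAux]

end Stmt

/-- A bound for the number of symbols that a machine pushes in one step. -/
def maxPushes (tm : FinTM2) : ℕ :=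
  letI := tm.ΛFin
  Finset.univ.sup fun l => pushes (tm.m l)

theorem pushes_le_maxPushes (tm : FinTM2) (l : tm.Λ) : pushes (tm.m l) ≤ maxPushes tm :=
  letI := tm.ΛFin
  Finset.le_sup (f := fun l => pushes (tm.m l)) (Finset.mem_univ l)

/-- The stacks of the machine when only the input stack is non-empty. -/
def inputStk (tm : FinTM2) (s : List (tm.Γ tm.k₀)) : ∀ k, List (tm.Γ k) :=
  (initList tm s).stk

theorem inputStk_eq_update (tm : FinTM2) (s : List (tm.Γ tm.k₀)) :
    inputStk tm s = Function.update (fun _ => []) tm.k₀ s := by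
  funext k
  by_cases h : k = tm.k₀
  · subst h; simp [inputStk, initList]
  · simp [inputStk, initList, h]

@[simp] theorem inputStk_self (tm : FinTM2) (s : List (tm.Γ tm.k₀)) :
    inputStk tm s tm.k₀ = s := by
  simp [inputStk_eq_update]

@[simp] theorem update_inputStk (tm : FinTM2) (s s' : List (tm.Γ tm.k₀)) :
    Function.update (inputStk tm s) tm.k₀ s' = inputStk tm s' := by
  simp [inputStk_eq_update]

theorem length_inputStk_le (tm : FinTM2) (s : List (tm.Γ tm.k₀)) (k : tm.K) :
    (inputStk tm s k).length ≤ s.length := by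
  rw [inputStk_eq_update]
  by_cases h : k = tm.k₀
  · subst h; simp
  · simp [h]

theorem QuantumTM.length_step_le {M : QuantumTM} {c d : M.Cfg} (h : d ∈ M.step c) (k : M.tm.K) :
    (d.classical.stk k).length ≤ (c.classical.stk k).length + maxPushes M.tm := by
  obtain ⟨⟨l, v, S⟩, hd, ψ⟩ := c
  cases l with
  | none => rw [step_of_halted rfl, List.mem_singleton] at h; subst h; exact Nat.le_add_right _ _
  | some l =>
    cases hl : M.instr l with
    | none =>
      rw [step_classical hl, List.mem_singleton] at h
      subst h
      exact (length_stepAux_le _ _ _ _).trans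
        (Nat.add_le_add_left (pushes_le_maxPushes _ _) _)
    | some i =>
      rw [step_quantum hl] at h
      obtain ⟨o, -, rfl⟩ := List.mem_map.mp h
      exact Nat.le_add_right _ _

/-- This bounds both the length of an output and the time needed to clear the stacks that a
subroutine leaves behind. -/
theorem QuantumTM.length_runFrom_le {M : QuantumTM} {c d : M.Cfg} {t : ℕ}
    (h : d ∈ M.runFrom c t) (k : M.tm.K) :
    (d.classical.stk k).length ≤ (c.classical.stk k).length + maxPushes M.tm * t := by
  induction t generalizing d with
  | zero => rw [runFrom, List.mem_singleton] at h; subst h; simp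
  | succ t ih =>
    rw [runFrom, List.mem_flatMap] at h
    obtain ⟨e, he, hd⟩ := h
    have := ih he
    have := length_step_le hd k
    rw [Nat.mul_succ]
    omega

/-! ### Polynomials -/

theorem eval_mono (p : Polynomial ℕ) {a b : ℕ} (h : a ≤ b) : p.eval a ≤ p.eval b := by
  rw [Polynomial.eval_eq_sum, Polynomial.eval_eq_sum]
  exact Finset.sum_le_sum fun i _ => Nat.mul_le_mul_left _ (Nat.pow_le_pow_left h i)

/-- Powers of `n + 2` are easy to compute in unary. The base is at least 2, so that larger exponents
absorb coefficients and sums. -/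
theorem exists_eval_le_pow (p : Polynomial ℕ) : ∃ k, ∀ n, p.eval n ≤ (n + 2) ^ k := by
  induction p using Polynomial.induction_on' with
  | add p q hp hq =>
    obtain ⟨a, ha⟩ := hp
    obtain ⟨b, hb⟩ := hq
    refine ⟨a + b + 1, fun n => ?_⟩
    have h1 : (n + 2) ^ a ≤ (n + 2) ^ (a + b) := Nat.pow_le_pow_right (by omega) (by omega)
    have h2 : (n + 2) ^ b ≤ (n + 2) ^ (a + b) := Nat.pow_le_pow_right (by omega) (by omega)
    have := ha n
    have := hb n
    rw [Polynomial.eval_add, pow_succ]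
    nlinarith
  | monomial j a =>
    refine ⟨a + j, fun n => ?_⟩
    rw [Polynomial.eval_monomial, pow_add]
    refine Nat.mul_le_mul ?_ (Nat.pow_le_pow_left (by omega) j)
    exact (Nat.lt_two_pow_self).le.trans (Nat.pow_le_pow_left (by omega) a)

/-! ### The decision problem of the bits of a function -/

/-- The `i`-th piece of information about a string: an even `i` asks whether the string is longer
than `i / 2`, an odd `i` asks for the bit at position `i / 2`. -/
def bitQuery : List Bool → ℕ → Bool
  | [], _ => false
  | _ :: _, 0 => true
  | b :: _, 1 => b
  | _ :: y, i + 2 => bitQuery y i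

/-- Read a string as a number `i` in unary, a separating `0`, and the rest. -/
def decodeQuery : List Bool → Option (ℕ × List Bool)
  | [] => none
  | false :: x => some (0, x)
  | true :: q => (decodeQuery q).map fun a => (a.1 + 1, a.2)

theorem decodeQuery_replicate_append (i : ℕ) (x : List Bool) :
    decodeQuery (List.replicate i true ++ false :: x) = some (i, x) := by
  induction i with
  | zero => rfl
  | succ i ih => rw [List.replicate_succ, List.cons_append, decodeQuery, ih]; rfl

/-- The decision problem of the bits of `f` on the inputs in `X`. -/
def bitProblem (X : Set (List Bool)) (f : List Bool → List Bool) : DecisionProblem where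
  yes := {q | ∃ i x, decodeQuery q = some (i, x) ∧ x ∈ X ∧ bitQuery (f x) i = true}
  no := {q | decodeQuery q = none ∨
    ∃ i x, decodeQuery q = some (i, x) ∧ x ∈ X ∧ bitQuery (f x) i = false}
  disjoint := by
    rw [Set.disjoint_left]
    rintro q ⟨i, x, hq, -, hb⟩ (h | ⟨j, z, hz, -, hb'⟩)
    · rw [hq] at h; cases h
    · rw [hq] at hz; cases hz; rw [hb] at hb'; cases hb'

/-- A string either is malformed, hence a no-instance, or decodes to a pair whose second component
is automatically valid. -/
theorem bitProblem_univ (f : List Bool → List Bool) :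
    bitProblem Set.univ f = DecisionProblem.ofLanguage (bitProblem Set.univ f).yes := by
  have : (bitProblem Set.univ f).no = (bitProblem Set.univ f).yesᶜ := by
    ext q
    constructor
    · exact fun h => Set.disjoint_right.mp (bitProblem Set.univ f).disjoint h
    · intro h
      rcases hq : decodeQuery q with _ | ⟨i, x⟩
      · exact Or.inl hq
      · refine Or.inr ⟨i, x, hq, trivial, ?_⟩
        by_contra hb
        exact h ⟨i, x, hq, trivial, by simpa using hb⟩
  cases h : bitProblem Set.univ f
  simp only [h] at this
  subst this
  rfl

/-! ### A quantum machine for the bits of an output. -/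

namespace QuantumTM

variable (M : QuantumTM)

/-- The stacks of `M.bitMachine`: those of `M`, a counter and an output stack. -/
abbrev bitΓ : M.tm.K ⊕ Bool → Type
  | .inl k => M.tm.Γ k
  | .inr _ => Bool

/-- The program of `M.bitMachine`: read the input up to the separator onto the counter, run `M` on
the rest, and look up a bit of its output. -/
def bitProgram : M.tm.Λ ⊕ Bool →
    TM2.Stmt M.bitΓ (M.tm.Λ ⊕ Bool) (M.tm.σ × Option Bool × Option Bool)
  | .inl l => embedStmt (Γ' := M.bitΓ) Sum.inl (fun _ a => a) (fun _ a => a) Sum.inl Prod.fst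
      (fun v w => (v, w.2)) (.goto fun _ => .inr true) (M.tm.m l)
  | .inr false =>
      .pop (.inl M.tm.k₀) (fun v o => (v.1, o.map M.inputAlphabet, none)) <|
      .branch (fun v => v.2.1.isNone)
        (.push (.inr true) (fun _ => false) .halt)
        (.branch (fun v => v.2.1 == some true)
          (.push (.inr false) (fun _ => true) (.goto fun _ => .inr false))
          (.goto fun _ => .inl M.tm.main))
  | .inr true =>
      .pop (.inr false) (fun v o => (v.1, o, none)) <|
      .branch (fun v => v.2.1.isNone)
        (.pop (.inl M.tm.k₁) (fun v o => (v.1, o.map M.outputAlphabet, none)) <|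
          .push (.inr true) (fun v => v.2.1.isSome) .halt)
        (.pop (.inr false) (fun v o => (v.1, o, none)) <|
          .pop (.inl M.tm.k₁) (fun v o => (v.1, v.2.1, o.map M.outputAlphabet)) <|
          .branch (fun v => v.2.2.isNone)
            (.push (.inr true) (fun _ => false) .halt)
            (.branch (fun v => v.2.1.isNone)
              (.push (.inr true) (fun v => v.2.2 == some true) .halt)
              (.goto fun _ => .inr true)))

/-- The classical control of `M.bitMachine`. -/
def bitTM : FinTM2 :=
  letI := M.tm.kFin
  letI := M.tm.ΛFin
  letI := M.tm.σFin
  letI : Fintype (M.bitΓ (.inl M.tm.k₀)) := M.tm.Γk₀Fin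
  { K := M.tm.K ⊕ Bool
    k₀ := .inl M.tm.k₀
    k₁ := .inr true
    Γ := M.bitΓ
    Λ := M.tm.Λ ⊕ Bool
    main := .inr false
    σ := M.tm.σ × Option Bool × Option Bool
    initialState := (M.tm.initialState, none, none)
    m := M.bitProgram }

/-- A machine that computes one piece of information about the output of `M`. -/
def bitMachine : QuantumTM where
  tm := M.bitTM
  inputAlphabet := M.inputAlphabet
  outputAlphabet := Equiv.refl Bool
  instr := Sum.elim M.instr fun _ => none
  next l b := l.elim (fun l => .inl (M.next l b)) fun b => .inr b

variable {M}

/-- The stacks of `M.bitMachine`. -/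
def bitStk (S : ∀ k, List (M.tm.Γ k)) (cnt out : List Bool) : ∀ k, List (M.bitΓ k)
  | .inl k => S k
  | .inr false => cnt
  | .inr true => out

variable {S : ∀ k, List (M.tm.Γ k)} {cnt out : List Bool}

@[simp] theorem bitStk_inl (k : M.tm.K) : bitStk S cnt out (.inl k) = S k := rfl
@[simp] theorem bitStk_false : bitStk S cnt out (.inr false) = cnt := rfl
@[simp] theorem bitStk_true : bitStk S cnt out (.inr true) = out := rfl

@[simp] theorem update_bitStk_inl (k : M.tm.K) (l : List (M.tm.Γ k)) :
    Function.update (bitStk S cnt out) (.inl k) l = bitStk (Function.update S k l) cnt out := by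
  funext k'
  rcases k' with k' | _ | _
  · by_cases h : k' = k
    · subst h; simp
    · simp [h]
  all_goals simp

@[simp] theorem update_bitStk_false (l : List Bool) :
    Function.update (bitStk S cnt out) (.inr false) l = bitStk S l out := by
  funext k'
  rcases k' with k' | _ | _ <;> simp

@[simp] theorem update_bitStk_true (l : List Bool) :
    Function.update (bitStk S cnt out) (.inr true) l = bitStk S cnt l := by
  funext k'
  rcases k' with k' | _ | _ <;> simp

/-- A configuration of `M.bitMachine`. -/
def bitCfg (l : Option (M.tm.Λ ⊕ Bool)) (v : M.tm.σ × Option Bool × Option Bool)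
    (S : ∀ k, List (M.tm.Γ k)) (cnt out : List Bool) (h : ℤ) (ψ : QState) : M.bitMachine.Cfg :=
  ⟨⟨l, v, bitStk S cnt out⟩, h, ψ⟩

theorem yields_bitCfg_halted (v : M.tm.σ × Option Bool × Option Bool) (h : ℤ) (ψ : QState)
    (t : ℕ) : M.bitMachine.Yields out t (bitCfg none v S cnt out h ψ) ψ.normSq := by
  have h1 := yields_of_halted (M := M.bitMachine) (y := out) (c := bitCfg none v S cnt out h ψ)
    rfl t
  have h2 : M.bitMachine.output (bitCfg none v S cnt out h ψ) = some out :=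
    congrArg some (List.map_id _)
  rw [weight, if_pos h2] at h1
  exact h1

/-- The successor enters through an equation, so that `simp` can execute the program in a hypothesis
before `subst` puts the result in place. -/
theorem yields_bitCfg_step {l : Bool} {y : List Bool} {t : ℕ}
    {v : M.tm.σ × Option Bool × Option Bool} {h : ℤ} {ψ : QState} {a : ℝ}
    (H : ∀ c : TM2.Cfg M.bitΓ (M.tm.Λ ⊕ Bool) (M.tm.σ × Option Bool × Option Bool),
      TM2.stepAux (M.bitProgram (.inr l)) v (bitStk S cnt out) = c →
      M.bitMachine.Yields y t ⟨c, h, ψ⟩ a) :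
    M.bitMachine.Yields y (t + 1) (bitCfg (some (.inr l)) v S cnt out h ψ) a :=
  yields_classical (M := M.bitMachine) (l := .inr l) rfl (H _ rfl)

/-- One round of the program removes two symbols from the counter and one from the output, just as
the recursion of `bitQuery` does; hence the strong induction with steps of two. -/
theorem yields_walk (i : ℕ) (v : M.tm.σ × Option Bool × Option Bool)
    (S : ∀ k, List (M.tm.Γ k)) (h : ℤ) (ψ : QState) :
    M.bitMachine.Yields [bitQuery ((S M.tm.k₁).map M.outputAlphabet) i] (i + 1)
      (bitCfg (some (.inr true)) v S (List.replicate i true) [] h ψ) ψ.normSq := by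
  induction i using Nat.strong_induction_on generalizing v S with
  | _ i ih =>
    refine yields_bitCfg_step fun c hc => ?_
    match i with
    | 0 =>
      rcases hS : S M.tm.k₁ with _ | ⟨b, y⟩ <;>
      · simp [bitProgram, hS] at hc
        subst hc
        exact yields_bitCfg_halted _ _ _ _
    | 1 =>
      rcases hS : S M.tm.k₁ with _ | ⟨b, y⟩
      · simp [bitProgram, hS] at hc
        subst hc
        exact yields_bitCfg_halted _ _ _ _
      · cases hb : M.outputAlphabet b <;>
        · simp [bitProgram, hS, hb] at hc
          subst hc
          simp only [List.map_cons, hb]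
          exact yields_bitCfg_halted _ _ _ _
    | i + 2 =>
      rcases hS : S M.tm.k₁ with _ | ⟨b, y⟩
      · simp [bitProgram, hS, List.replicate_succ] at hc
        subst hc
        exact yields_bitCfg_halted _ _ _ _
      · simp [bitProgram, hS, List.replicate_succ] at hc
        subst hc
        have := ih i (by omega) (v.1, some true, some (M.outputAlphabet b))
          (Function.update S M.tm.k₁ y)
        simp only [Function.update_self] at this
        exact this.mono_time (by omega)

/-- With value zero only the halting statement survives, and this does not depend on the output. It
handles branches with a wrong output. -/
theorem Yields.zero {N : QuantumTM} {y y' : List Bool} {t : ℕ} {c : N.Cfg} {a : ℝ}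
    (h : N.Yields y t c a) : N.Yields y' t c 0 := by
  refine ⟨h.1, List.sum_nonneg fun a ha => ?_⟩
  obtain ⟨d, -, rfl⟩ := List.mem_map.mp ha
  exact weight_nonneg y' d

/-- The configuration of `M.bitMachine` that corresponds to one of `M`. -/
def bitEmbed (r : Option Bool × Option Bool) (cnt : List Bool) (c : M.Cfg) : M.bitMachine.Cfg :=
  bitCfg (some (c.classical.l.elim (.inr true) .inl)) (c.classical.var, r) c.classical.stk cnt []
    c.head c.state

theorem step_bitEmbed (r : Option Bool × Option Bool) (cnt : List Bool) (c : M.Cfg)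
    (hc : c.classical.l ≠ none) :
    M.bitMachine.step (bitEmbed r cnt c) = (M.step c).map (bitEmbed r cnt) := by
  obtain ⟨⟨l, v, S⟩, h, ψ⟩ := c
  obtain ⟨l, rfl⟩ := Option.ne_none_iff_exists'.mp hc
  cases hl : M.instr l with
  | none =>
    rw [step_classical hl, bitEmbed, bitCfg]
    refine (step_classical (M := M.bitMachine) (l := .inl l) hl _ _ h ψ).trans ?_
    have := stepAux_embedStmt (Γ' := M.bitΓ) (ι := Sum.inl) (e := fun _ a => a)
      (ei := fun _ a => a) (lab := (Sum.inl : _ → M.tm.Λ ⊕ Bool)) (get := Prod.fst)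
      (set := fun v w => (v, w.2)) (H := .goto fun _ => .inr true)
      (fun v => (v, r)) (fun S => bitStk S cnt []) (fun _ _ => rfl) (fun _ => rfl)
      (fun _ _ => rfl) (fun _ _ => (List.map_id _).symm)
      (fun _ _ _ => by simp) (M.tm.m l) v S
    rw [List.map_singleton]
    refine congrArg (fun c => [(⟨c, h, ψ⟩ : M.bitMachine.Cfg)]) (this.trans ?_)
    rcases TM2.stepAux (M.tm.m l) v S with ⟨_ | l', w, T⟩ <;> rfl
  | some i =>
    rw [step_quantum hl, bitEmbed, bitCfg, List.map_map]
    exact step_quantum (M := M.bitMachine) (l := .inl l) hl _ _ h ψ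

/-- A branch on which `M` outputs `y` passes its whole weight on to the correct answer; the other
branches are counted as zero. -/
theorem yields_run {p : Polynomial ℕ} (hp : M.RunsInTime p) (x y : List Bool) (i : ℕ)
    (r : Option Bool × Option Bool) :
    M.bitMachine.Yields [bitQuery y i] (p.eval x.length + (i + 1))
      (bitEmbed r (List.replicate i true) (M.init x)) (M.outputProb x (p.eval x.length) y) := by
  rw [outputProb, run_eq_runFrom]
  refine yields_of_simulation _ (step_bitEmbed r _) (fun _ => rfl) (M.weight y)
    (fun c h => weight_eq_zero h y) _ _ _ ?_ ?_
  · rw [← run_eq_runFrom]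
    exact hp x
  · intro d _ hd
    have h := yields_walk i (d.classical.var, r) d.classical.stk d.head d.state
    have he : bitEmbed r (List.replicate i true) d = bitCfg (some (.inr true))
      (d.classical.var, r) d.classical.stk (List.replicate i true) [] d.head d.state := by
      simp [bitEmbed, hd]
    rw [he, weight]
    split_ifs with ho
    · rw [output, if_pos (by simp [hd]), Option.some.injEq] at ho
      rw [← ho]
      exact h
    · exact h.zero

theorem yields_scan_none {q : List Bool} (hq : decodeQuery q = none) (v : Option Bool × Option Bool)
    (cnt : List Bool) (h : ℤ) (ψ : QState) :
    M.bitMachine.Yields [false] (q.length + 1) (bitCfg (some (.inr false))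
      (M.tm.initialState, v) (inputStk M.tm (q.map M.inputAlphabet.symm)) cnt [] h ψ)
      ψ.normSq := by
  induction q generalizing v cnt with
  | nil =>
    refine yields_bitCfg_step fun c hc => ?_
    simp [bitProgram] at hc
    subst hc
    exact yields_bitCfg_halted _ _ _ _
  | cons b q ih =>
    cases b with
    | false => cases hq
    | true =>
      refine yields_bitCfg_step fun c hc => ?_
      simp [bitProgram] at hc
      subst hc
      exact ih (by simpa [decodeQuery] using hq) _ _

/-- The induction needs an arbitrary initial height `i` of the counter, as the prefix is moved there
symbol by symbol. -/
theorem yields_scan_some {q x y : List Bool} {i j t : ℕ} (hq : decodeQuery q = some (j, x))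
    (r : Option Bool × Option Bool) {a : ℝ} (h : ℤ) (ψ : QState)
    (H : ∀ r, M.bitMachine.Yields y t (bitCfg (some (.inl M.tm.main)) (M.tm.initialState, r)
      (inputStk M.tm (x.map M.inputAlphabet.symm)) (List.replicate (i + j) true) [] h ψ) a) :
    M.bitMachine.Yields y (t + q.length) (bitCfg (some (.inr false)) (M.tm.initialState, r)
      (inputStk M.tm (q.map M.inputAlphabet.symm)) (List.replicate i true) [] h ψ) a := by
  induction q generalizing i j r with
  | nil => cases hq
  | cons b q ih =>
    refine yields_bitCfg_step fun c hc => ?_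
    cases b with
    | false =>
      cases hq
      simp [bitProgram] at hc
      subst hc
      exact (H _).mono_time (Nat.le_add_right _ _)
    | true =>
      rw [decodeQuery, Option.map_eq_some_iff] at hq
      obtain ⟨⟨j', x'⟩, hq, he⟩ := hq
      cases he
      simp [bitProgram] at hc
      subst hc
      refine ih (i := i + 1) hq _ fun r => ?_
      rw [show i + 1 + j' = i + (j' + 1) by omega]
      exact H r

theorem Yields.outputProb_le {N : QuantumTM} {x y : List Bool} {t : ℕ} {a : ℝ}
    (h : N.Yields y t (N.init x) a) : a ≤ N.outputProb x t y := by
  rw [outputProb, run_eq_runFrom]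
  exact h.2

theorem runsInTime_of_yields {N : QuantumTM} {p : Polynomial ℕ}
    (h : ∀ x, ∃ y a, N.Yields y (p.eval x.length) (N.init x) a) : N.RunsInTime p := by
  intro x
  obtain ⟨y, a, h⟩ := h x
  rw [run_eq_runFrom]
  exact h.1

theorem length_decodeQuery {q x : List Bool} {i : ℕ} (h : decodeQuery q = some (i, x)) :
    x.length + i ≤ q.length := by
  induction q generalizing i with
  | nil => cases h
  | cons b q ih =>
    cases b with
    | false => cases h; simp
    | true =>
      rw [decodeQuery, Option.map_eq_some_iff] at h
      obtain ⟨⟨j, x'⟩, h, he⟩ := h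
      cases he
      have := ih h
      simp only [List.length_cons] at this ⊢
      omega

theorem init_bitMachine (q : List Bool) :
    M.bitMachine.init q = bitCfg (some (.inr false)) (M.tm.initialState, none, none)
      (inputStk M.tm (q.map M.inputAlphabet.symm)) [] [] 0 QState.zero := by
  have : (initList M.bitTM (q.map M.inputAlphabet.symm)).stk =
      bitStk (inputStk M.tm (q.map M.inputAlphabet.symm)) [] [] := by
    refine (inputStk_eq_update M.bitTM _).trans ?_
    rw [inputStk_eq_update, ← update_bitStk_inl]
    refine congrArg (fun S => Function.update S (Sum.inl M.tm.k₀) _) ?_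
    funext k
    rcases k with k | _ | _ <;> rfl
  exact congrArg (fun S => (⟨⟨some (.inr false), (M.tm.initialState, none, none), S⟩, 0,
    QState.zero⟩ : M.bitMachine.Cfg)) this

/-- If `M` outputs `f x` with probability at least `2/3` on the inputs in `X`, then the decision
problem of the bits of `f` is in BQP. -/
theorem inBQP_bitProblem {p : Polynomial ℕ} (hp : M.RunsInTime p) {X : Set (List Bool)}
    {f : List Bool → List Bool}
    (hf : ∀ x ∈ X, 2 / 3 ≤ M.outputProb x (p.eval x.length) (f x)) :
    (bitProblem X f).InBQP := by
  -- Scanning a query `q = 1^i 0 x` takes at most `|q|` steps, the run of `M` takes `p(|x|)` and the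
  -- lookup `i + 1`, where `|x|` and `i` are at most `|q|`.
  let P : Polynomial ℕ := p + 2 * Polynomial.X + 1
  have hP : ∀ n, P.eval n = p.eval n + 2 * n + 1 := fun n => by simp [P]
  have hnone : ∀ q, decodeQuery q = none →
      M.bitMachine.Yields [false] (P.eval q.length) (M.bitMachine.init q) 1 := fun q hq => by
    rw [init_bitMachine, ← normSq_zeroState]
    exact (yields_scan_none hq _ _ _ _).mono_time (by rw [hP]; omega)
  have hsome : ∀ q i x y, decodeQuery q = some (i, x) →
      M.bitMachine.Yields [bitQuery y i] (P.eval q.length) (M.bitMachine.init q)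
        (M.outputProb x (p.eval x.length) y) := fun q i x y hq => by
    have hl := length_decodeQuery hq
    have := eval_mono p (show x.length ≤ q.length by omega)
    rw [init_bitMachine]
    refine (yields_scan_some (i := 0) hq _ _ _ fun r => ?_).mono_time
      (?_ : p.eval x.length + (i + 1) + q.length ≤ _)
    · rw [Nat.zero_add]
      exact yields_run hp x y i r
    · rw [hP]
      omega
  refine ⟨M.bitMachine, P, runsInTime_of_yields fun q => ?_, ?_, ?_⟩
  · rcases hq : decodeQuery q with _ | ⟨i, x⟩
    · exact ⟨_, _, hnone q hq⟩
    -- The string `[]` is arbitrary: here only halting matters.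
    · exact ⟨_, _, hsome q i x [] hq⟩
  · rintro q ⟨i, x, hq, hx, hb⟩
    have := (hsome q i x (f x) hq).outputProb_le
    rw [hb] at this
    exact (hf x hx).trans this
  · rintro q (hq | ⟨i, x, hq, hx, hb⟩)
    · exact le_trans (by norm_num) (hnone q hq).outputProb_le
    · have := (hsome q i x (f x) hq).outputProb_le
      rw [hb] at this
      exact (hf x hx).trans this

end QuantumTM

/-! ### Runs of oracle machines -/

namespace OracleTM

/-- From `c`, with an oracle for `D`, the machine asks only about inputs of `D`, and it outputs `y`
within `t` steps. -/
def Solves (M : OracleTM) (D : DecisionProblem) (y : List Bool) (t : ℕ) (c : M.tm.Cfg) : Prop :=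
  (∀ s : ℕ, ((M.step D.yes)^[s] c).l = some M.query →
    M.queryString ((M.step D.yes)^[s] c) ∈ D.yes ∪ D.no) ∧
  M.output ((M.step D.yes)^[t] c) = some y

variable {M : OracleTM} {D : DecisionProblem} {y : List Bool} {t t' : ℕ} {c : M.tm.Cfg}

theorem step_of_halted {O : Set (List Bool)} (h : c.l = none) : M.step O c = c := by
  obtain ⟨l, v, S⟩ := c
  cases h
  simp only [step, reduceCtorEq]
  rfl

theorem step_classical {O : Set (List Bool)} {l : M.tm.Λ} (hl : l ≠ M.query) (v : M.tm.σ)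
    (S : ∀ k, List (M.tm.Γ k)) : M.step O ⟨some l, v, S⟩ = TM2.stepAux (M.tm.m l) v S := by
  simp only [step, Option.some.injEq, hl]
  rfl

open Classical in
theorem step_query (O : Set (List Bool)) (v : M.tm.σ) (S : ∀ k, List (M.tm.Γ k)) :
    M.step O ⟨some M.query, v, S⟩ =
      ⟨some (if (S M.queryStack).map M.queryAlphabet ∈ O then M.ansYes else M.ansNo), v,
        Function.update S M.queryStack []⟩ :=
  if_pos rfl

theorem iterate_step_of_halted {O : Set (List Bool)} (h : c.l = none) (t : ℕ) :
    (M.step O)^[t] c = c :=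
  Function.iterate_fixed (step_of_halted h) t

theorem halted_of_output (h : M.output c = some y) : c.l = none := by
  unfold output at h
  split_ifs at h with hl
  exact Option.isNone_iff_eq_none.mp hl

theorem solves_of_output (h : M.output c = some y) (t : ℕ) : M.Solves D y t c := by
  have hl := halted_of_output h
  constructor
  · intro s hs
    rw [iterate_step_of_halted hl, hl] at hs
    cases hs
  · rw [iterate_step_of_halted hl, h]

theorem Solves.mono_time (h : M.Solves D y t c) (ht : t ≤ t') : M.Solves D y t' c := by
  refine ⟨h.1, ?_⟩
  obtain ⟨s, rfl⟩ := Nat.exists_eq_add_of_le ht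
  rw [Nat.add_comm, Function.iterate_add_apply, iterate_step_of_halted (halted_of_output h.2)]
  exact h.2

/-- The backward rule for oracle machines; the legality of a query has to be checked only at the
first configuration. -/
theorem solves_of_step (hc : c.l = some M.query → M.queryString c ∈ D.yes ∪ D.no)
    (h : M.Solves D y t (M.step D.yes c)) : M.Solves D y (t + 1) c := by
  refine ⟨fun s hs => ?_, h.2⟩
  cases s with
  | zero => exact hc hs
  | succ s => exact h.1 s hs

theorem Solves.step (h : M.Solves D y (t + 1) c) : M.Solves D y t (M.step D.yes c) :=
  ⟨fun s hs => h.1 (s + 1) hs, h.2⟩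

end OracleTM

/-! ### An oracle machine that collects the bits of a function -/

namespace BitCollector

/-- The stacks: the input, the query, a counter, the answers, the output, and two auxiliary
stacks. -/
inductive Stack
  | inp | tmp | qry | cnt | aux | ans | out
  deriving DecidableEq

instance : Fintype Stack :=
  ⟨{.inp, .tmp, .qry, .cnt, .aux, .ans, .out}, fun k => by cases k <;> simp⟩

/-- The labels. -/
inductive Label
  | down | up | countDown | countUp | query | yes | no | collect
  deriving DecidableEq

instance : Fintype Label :=
  ⟨{.down, .up, .countDown, .countUp, .query, .yes, .no, .collect},
    fun k => by cases k <;> simp⟩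

/-- The variables: the parity of the counter, and a symbol. -/
abbrev Var : Type := Bool × Option Bool

/-- Copy the input and the counter to the query stack, ask, and record the answer; at the end, move
the answers to the output stack. -/
def program : Label → TM2.Stmt (fun _ : Stack => Bool) Label Var
  | .down =>
      .pop .inp (fun v o => (v.1, o)) <|
      .branch (fun v => v.2.isNone) (.goto fun _ => .up)
        (.push .tmp (fun v => v.2 == some true) (.goto fun _ => .down))
  | .up =>
      .pop .tmp (fun v o => (v.1, o)) <|
      .branch (fun v => v.2.isNone) (.push .qry (fun _ => false) (.goto fun _ => .countDown))
        (.push .inp (fun v => v.2 == some true) <|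
          .push .qry (fun v => v.2 == some true) (.goto fun _ => .up))
  | .countDown =>
      .pop .cnt (fun v o => (v.1, o)) <|
      .branch (fun v => v.2.isNone) (.goto fun _ => .countUp)
        (.push .aux (fun _ => true) <| .push .qry (fun _ => true) (.goto fun _ => .countDown))
  | .countUp =>
      .pop .aux (fun v o => (v.1, o)) <|
      .branch (fun v => v.2.isNone) (.goto fun _ => .query)
        (.push .cnt (fun _ => true) (.goto fun _ => .countUp))
  | .query => .halt
  | .yes =>
      .push .cnt (fun _ => true) <|
      .branch (fun v => v.1)
        (.push .ans (fun _ => true) <| .load (fun v => (false, v.2)) (.goto fun _ => .down))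
        (.load (fun v => (true, v.2)) (.goto fun _ => .down))
  | .no =>
      .branch (fun v => v.1)
        (.push .cnt (fun _ => true) <| .push .ans (fun _ => false) <|
          .load (fun v => (false, v.2)) (.goto fun _ => .down))
        (.goto fun _ => .collect)
  | .collect =>
      .pop .ans (fun v o => (v.1, o)) <|
      .branch (fun v => v.2.isNone) .halt
        (.push .out (fun v => v.2 == some true) (.goto fun _ => .collect))

/-- The oracle machine. -/
def machine : OracleTM where
  tm :=
    { K := Stack
      k₀ := .inp
      k₁ := .out
      Γ := fun _ => Bool
      Λ := Label
      main := .down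
      σ := Var
      initialState := (false, none)
      Γk₀Fin := inferInstanceAs (Fintype Bool)
      m := program }
  inputAlphabet := Equiv.refl Bool
  outputAlphabet := Equiv.refl Bool
  queryStack := .qry
  queryAlphabet := Equiv.refl Bool
  query := .query
  ansYes := .yes
  ansNo := .no

/-- The stacks, given their contents. -/
def stk (inp tmp qry cnt aux ans out : List Bool) : Stack → List Bool
  | .inp => inp
  | .tmp => tmp
  | .qry => qry
  | .cnt => cnt
  | .aux => aux
  | .ans => ans
  | .out => out

section update

variable (inp tmp qry cnt aux ans out l : List Bool)

@[simp] theorem update_inp : Function.update (stk inp tmp qry cnt aux ans out) .inp l =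
    stk l tmp qry cnt aux ans out := by funext k; cases k <;> rfl
@[simp] theorem update_tmp : Function.update (stk inp tmp qry cnt aux ans out) .tmp l =
    stk inp l qry cnt aux ans out := by funext k; cases k <;> rfl
@[simp] theorem update_qry : Function.update (stk inp tmp qry cnt aux ans out) .qry l =
    stk inp tmp l cnt aux ans out := by funext k; cases k <;> rfl
@[simp] theorem update_cnt : Function.update (stk inp tmp qry cnt aux ans out) .cnt l =
    stk inp tmp qry l aux ans out := by funext k; cases k <;> rfl
@[simp] theorem update_aux : Function.update (stk inp tmp qry cnt aux ans out) .aux l =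
    stk inp tmp qry cnt l ans out := by funext k; cases k <;> rfl
@[simp] theorem update_ans : Function.update (stk inp tmp qry cnt aux ans out) .ans l =
    stk inp tmp qry cnt aux l out := by funext k; cases k <;> rfl
@[simp] theorem update_out : Function.update (stk inp tmp qry cnt aux ans out) .out l =
    stk inp tmp qry cnt aux ans l := by funext k; cases k <;> rfl

end update

/-- A configuration. -/
def cfg (l : Option Label) (v : Var) (inp tmp qry cnt aux ans out : List Bool) :
    machine.tm.Cfg :=
  ⟨l, v, stk inp tmp qry cnt aux ans out⟩

variable {D : DecisionProblem} {y : List Bool} {t : ℕ} {v : Var}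
  {inp tmp qry cnt aux ans out : List Bool}

theorem solves_step {l : Label} (hl : l ≠ .query)
    (H : ∀ c : TM2.Cfg (fun _ : Stack => Bool) Label Var,
      TM2.stepAux (program l) v (stk inp tmp qry cnt aux ans out) = c → machine.Solves D y t c) :
    machine.Solves D y (t + 1) (cfg (some l) v inp tmp qry cnt aux ans out) := by
  have hq : (cfg (some l) v inp tmp qry cnt aux ans out).l ≠ some machine.query :=
    fun h => hl (Option.some.inj h)
  exact OracleTM.solves_of_step (fun h => (hq h).elim)
    ((congrArg (machine.Solves D y t)
      (OracleTM.step_classical (M := machine) hl v _)).mpr (H _ rfl))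

/-- The latest answer is on top of `ans`, so moving the stack to `out` restores the order of the
bits. -/
theorem solves_collect (hy : ans.reverse ++ out = y) :
    machine.Solves D y (ans.length + 1) (cfg (some .collect) v inp tmp qry cnt aux ans out) := by
  induction ans generalizing v out with
  | nil =>
    refine solves_step (by simp) fun c hc => ?_
    simp [program, stk] at hc
    subst hc
    refine OracleTM.solves_of_output ?_ _
    rw [← hy]
    exact congrArg some (List.map_id _)
  | cons b ans ih =>
    refine solves_step (by simp) fun c hc => ?_
    simp [program, stk] at hc
    subst hc
    exact ih (by simpa using hy)

/-- The loops overwrite the symbol component of the variable but keep the parity. Therefore the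
continuation is assumed for every `v` of parity `p`; the same holds for the next three loops. -/
theorem solves_countUp (H : ∀ v, v.1 = p → machine.Solves D y t (cfg (some .query) v inp tmp qry
      (List.replicate (i + j) true) [] ans out)) (hv : v.1 = p) :
    machine.Solves D y (t + i + 1) (cfg (some .countUp) v inp tmp qry (List.replicate j true)
      (List.replicate i true) ans out) := by
  induction i generalizing v j with
  | zero =>
    refine solves_step (by simp) fun c hc => ?_
    simp [program, stk] at hc
    subst hc
    subst hv
    have := H (v.1, none) rfl
    rw [Nat.zero_add] at this
    exact this
  | succ i ih =>
    refine solves_step (by simp) fun c hc => ?_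
    simp [program, stk, List.replicate_succ] at hc
    subst hc
    refine ih (j := j + 1) (fun v hv => ?_) (v := (v.1, some true)) hv
    rw [show i + (j + 1) = i + 1 + j by omega]
    exact H v hv

/-- The counter is moved to `aux` while a copy of it lands on the query stack; `solves_countUp`
moves it back. -/
theorem solves_countDown (H : ∀ v, v.1 = p → machine.Solves D y t (cfg (some .countUp) v inp tmp
      (List.replicate i true ++ qry) [] (List.replicate (i + j) true) ans out)) (hv : v.1 = p) :
    machine.Solves D y (t + i + 1) (cfg (some .countDown) v inp tmp qry (List.replicate i true)
      (List.replicate j true) ans out) := by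
  induction i generalizing v j qry with
  | zero =>
    refine solves_step (by simp) fun c hc => ?_
    simp [program, stk] at hc
    subst hc
    subst hv
    have := H (v.1, none) rfl
    rw [Nat.zero_add] at this
    exact this
  | succ i ih =>
    refine solves_step (by simp) fun c hc => ?_
    simp [program, stk, List.replicate_succ] at hc
    subst hc
    refine ih (j := j + 1) (qry := true :: qry) (fun v hv => ?_) (v := (v.1, some true)) hv
    have := H v hv
    rw [show i + (j + 1) = i + 1 + j by omega]
    rwa [List.replicate_succ', List.append_assoc] at this

theorem solves_up (H : ∀ v, v.1 = p → machine.Solves D y t (cfg (some .countDown) v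
      (tmp.reverse ++ inp) [] (false :: (tmp.reverse ++ qry)) cnt aux ans out)) (hv : v.1 = p) :
    machine.Solves D y (t + tmp.length + 1)
      (cfg (some .up) v inp tmp qry cnt aux ans out) := by
  induction tmp generalizing v inp qry with
  | nil =>
    refine solves_step (by simp) fun c hc => ?_
    simp [program, stk] at hc
    subst hc
    subst hv
    exact H (v.1, none) rfl
  | cons b tmp ih =>
    refine solves_step (by simp) fun c hc => ?_
    simp [program, stk] at hc
    subst hc
    refine ih (inp := b :: inp) (qry := b :: qry) (fun v hv => ?_) (v := (v.1, some b)) hv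
    simpa using H v hv

theorem solves_down (H : ∀ v, v.1 = p → machine.Solves D y t (cfg (some .up) v [] 
      (inp.reverse ++ tmp) qry cnt aux ans out)) (hv : v.1 = p) :
    machine.Solves D y (t + inp.length + 1)
      (cfg (some .down) v inp tmp qry cnt aux ans out) := by
  induction inp generalizing v tmp with
  | nil =>
    refine solves_step (by simp) fun c hc => ?_
    simp [program, stk] at hc
    subst hc
    subst hv
    exact H (v.1, none) rfl
  | cons b inp ih =>
    refine solves_step (by simp) fun c hc => ?_
    simp [program, stk] at hc
    subst hc
    refine ih (tmp := b :: tmp) (fun v hv => ?_) (v := (v.1, some b)) hv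
    simpa using H v hv

open Classical in
theorem solves_query {a : Bool} (hyes : a = true → qry ∈ D.yes) (hno : a = false → qry ∈ D.no)
    (H : machine.Solves D y t (cfg (some (if a then .yes else .no)) v inp tmp [] cnt aux ans out)) :
    machine.Solves D y (t + 1) (cfg (some .query) v inp tmp qry cnt aux ans out) := by
  have hq : machine.queryString (cfg (some .query) v inp tmp qry cnt aux ans out) = qry :=
    List.map_id _
  have hmem : qry ∈ D.yes ↔ a = true := by
    cases a
    · simpa using Set.disjoint_right.mp D.disjoint (hno rfl)
    · simpa using hyes rfl
  refine OracleTM.solves_of_step (fun _ => ?_) ?_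
  · rw [hq]
    cases a
    · exact Or.inr (hno rfl)
    · exact Or.inl (hyes rfl)
  · refine (congrArg (machine.Solves D y t)
      (OracleTM.step_query (M := machine) D.yes v (stk inp tmp qry cnt aux ans out))).mpr ?_
    have hu : Function.update (stk inp tmp qry cnt aux ans out) .qry [] =
      stk inp tmp [] cnt aux ans out := update_qry ..
    have hl : (if (stk inp tmp qry cnt aux ans out .qry).map machine.queryAlphabet ∈ D.yes
        then Label.yes else .no) = if a then .yes else .no := by
      have : (stk inp tmp qry cnt aux ans out .qry).map machine.queryAlphabet = qry := hq
      simp only [this, hmem]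
    exact (congrArg₂ (fun (l : Label) S => machine.Solves D y t ⟨some l, v, S⟩) hl hu).mpr H

/-- One round: ask for the `i`-th piece of information. -/
theorem solves_round {X : Set (List Bool)} {f : List Bool → List Bool} {x : List Bool}
    (hx : x ∈ X) {i : ℕ} {p : Bool}
    (H : ∀ v, v.1 = p → machine.Solves (bitProblem X f) y t
      (cfg (some (if bitQuery (f x) i then .yes else .no)) v x [] [] (List.replicate i true) []
        ans out)) (hv : v.1 = p) :
    machine.Solves (bitProblem X f) y (t + (2 * x.length + 2 * i + 5))
      (cfg (some .down) v x [] [] (List.replicate i true) [] ans out) := by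
  have hq := decodeQuery_replicate_append i x
  have h0 : ∀ v, v.1 = p → machine.Solves (bitProblem X f) y (t + 1)
      (cfg (some .query) v x [] (List.replicate i true ++ false :: x) (List.replicate i true) []
        ans out) := fun v hv =>
    solves_query (fun h => ⟨i, x, hq, hx, h⟩) (fun h => Or.inr ⟨i, x, hq, hx, h⟩) (H v hv)
  have h1 := fun v hv => solves_countUp (i := i) (j := 0) (v := v) (p := p) h0 hv
  have h2 := fun v hv => solves_countDown (i := i) (j := 0) (v := v) (p := p) h1 hv
  have h3 := fun v hv => solves_up (tmp := x.reverse) (inp := []) (qry := []) (v := v) (p := p)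
    (by simpa using h2) hv
  have h4 := solves_down (inp := x) (tmp := []) (v := v) (p := p) (by simpa using h3) hv
  exact h4.mono_time (by omega)

theorem bitQuery_append (a b : List Bool) (i : ℕ) :
    bitQuery (a ++ b) (2 * a.length + i) = bitQuery b i := by
  induction a with
  | nil => simp
  | cons c a ih =>
    rw [List.length_cons, show 2 * (a.length + 1) + i = 2 * a.length + i + 2 by omega]
    exact ih

/-- Invariant of the outer loop: the bits `a` have been found and lie reversed on `ans`, and the
counter is at the length question after them. The induction is on the unknown rest `b`. -/
theorem solves_main {X : Set (List Bool)} {f : List Bool → List Bool} {x : List Bool}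
    (hx : x ∈ X) (a b : List Bool) (hab : f x = a ++ b) (hv : v.1 = false) :
    machine.Solves (bitProblem X f) (f x)
      ((2 * b.length + 1) * (2 * x.length + 4 * (f x).length + 8) + (f x).length + 1)
      (cfg (some .down) v x [] [] (List.replicate (2 * a.length) true) [] a.reverse []) := by
  have hlen : (f x).length = a.length + b.length := by rw [hab, List.length_append]
  induction b generalizing a v with
  | nil =>
    have hb : bitQuery (f x) (2 * a.length) = false := by
      rw [hab]; exact bitQuery_append a [] 0
    refine OracleTM.Solves.mono_time (solves_round (i := 2 * a.length)
      (t := (a.reverse.length + 1) + 1) hx (p := false) (fun v hv => ?_) hv) ?_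
    · rw [hb]
      refine solves_step (by simp) fun c hc => ?_
      simp [program, hv] at hc
      subst hc
      exact solves_collect (by simpa using hab.symm)
    · simp only [List.length_reverse, List.length_nil] at hlen ⊢
      omega
  | cons c b ih =>
    have hb0 : bitQuery (f x) (2 * a.length) = true := by
      rw [hab]; exact bitQuery_append a (c :: b) 0
    have hb1 : bitQuery (f x) (2 * a.length + 1) = c := by
      rw [hab]; exact bitQuery_append a (c :: b) 1
    have hab' : f x = (a ++ [c]) ++ b := by simpa using hab
    have key := fun v hv => ih (v := v) (a ++ [c]) hab' hv (by rw [hab', List.length_append])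
    simp only [List.reverse_append, List.reverse_singleton, List.singleton_append,
      List.length_append, List.length_singleton] at key
    -- A bound for one round with the step that records its answer: the index is at most `2 *
    -- a.length + 1`. Each bit takes two rounds, and one more discovers the end.
    set B := 2 * x.length + 4 * (f x).length + 8 with hB
    set t := (2 * b.length + 1) * B + (f x).length + 1 with ht
    have h1 : ∀ v, v.1 = true → machine.Solves (bitProblem X f) (f x)
        (t + 1 + (2 * x.length + 2 * (2 * a.length + 1) + 5))
        (cfg (some .down) v x [] [] (List.replicate (2 * a.length + 1) true) [] a.reverse []) := by
      refine fun v hv => solves_round hx (p := true) (fun v hv => ?_) hv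
      rw [hb1]
      cases c <;>
      · refine solves_step (by simp) fun c hc => ?_
        simp [program, hv, stk, ← List.replicate_succ] at hc
        subst hc
        exact key (false, v.2) rfl
    have h2 : machine.Solves (bitProblem X f) (f x)
        (t + 1 + (2 * x.length + 2 * (2 * a.length + 1) + 5) + 1 +
          (2 * x.length + 2 * (2 * a.length) + 5))
        (cfg (some .down) v x [] [] (List.replicate (2 * a.length) true) [] a.reverse []) := by
      refine solves_round hx (p := false) (fun v hv => ?_) hv
      rw [hb0]
      refine solves_step (by simp) fun c hc => ?_
      simp [program, hv, stk, ← List.replicate_succ] at hc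
      subst hc
      exact h1 (true, v.2) rfl
    refine h2.mono_time ?_
    simp only [List.length_cons] at hlen ⊢
    rw [ht, show (2 * (b.length + 1) + 1) * B = (2 * b.length + 1) * B + B + B by ring]
    omega

theorem solves_init {X : Set (List Bool)} (f : List Bool → List Bool) {x : List Bool}
    (hx : x ∈ X) :
    machine.Solves (bitProblem X f) (f x)
      ((2 * (f x).length + 1) * (2 * x.length + 4 * (f x).length + 8) + (f x).length + 1)
      (initList machine.tm (x.map machine.inputAlphabet.symm)) := by
  have h := solves_main (f := f) (v := (false, none)) hx [] (f x) rfl rfl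
  have he : initList machine.tm (x.map machine.inputAlphabet.symm) =
      cfg (some .down) (false, none) x [] [] [] [] [] [] := by
    refine congrArg (fun S => (⟨some .down, (false, none), S⟩ : machine.tm.Cfg)) ?_
    funext k
    cases k
    case inp => exact List.map_id x
    all_goals rfl
  rw [he]
  exact h

end BitCollector

/-! ### Length of outputs, and the reduction obtained from an algorithm. -/

theorem QuantumTM.length_le_of_outputProb_pos {M : QuantumTM} {x y : List Bool} {t : ℕ}
    (h : 0 < M.outputProb x t y) : y.length ≤ x.length + maxPushes M.tm * t := by
  by_contra hlt
  refine absurd h (not_lt.mpr (le_of_eq ?_))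
  rw [outputProb, run_eq_runFrom]
  refine List.sum_eq_zero fun a ha => ?_
  obtain ⟨c, hc, rfl⟩ := List.mem_map.mp ha
  -- A branch can output `y` only if enough symbols were pushed; otherwise every summand of the
  -- probability vanishes.
  refine if_neg fun ho => hlt ?_
  have h1 := length_runFrom_le hc M.tm.k₁
  have h2 := length_inputStk_le M.tm (x.map M.inputAlphabet.symm) M.tm.k₁
  have h3 : (c.classical.stk M.tm.k₁).length = y.length := by
    rw [output, if_pos (by simp [halted_of_output ho]), Option.some.injEq] at ho
    rw [← ho, List.length_map]
  rw [List.length_map] at h2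
  rw [← h3]
  exact h1.trans (Nat.add_le_add_right h2 _)

/-- A search problem with a pseudo-deterministic algorithm reduces to the problem of the bits of the
solution. -/
theorem SearchProblem.pReducible_bitProblem {R : SearchProblem} {f : List Bool → List Bool}
    (hf : ∀ x ∈ R.dom, (x, f x) ∈ R.rel) (L : Polynomial ℕ)
    (hL : ∀ x ∈ R.dom, (f x).length ≤ L.eval x.length) :
    R.PReducible (bitProblem R.dom f) := by
  refine ⟨BitCollector.machine,
    (2 * L + 1) * (2 * Polynomial.X + 4 * L + 8) + L + 1, fun x hx => ?_⟩
  have h := (BitCollector.solves_init f hx).mono_time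
    (t' := ((2 * L + 1) * (2 * Polynomial.X + 4 * L + 8) + L + 1).eval x.length) (by
      have := hL x hx
      simp only [Polynomial.eval_add, Polynomial.eval_mul, Polynomial.eval_X,
        Polynomial.eval_ofNat, Polynomial.eval_one]
      gcongr)
  exact ⟨h.1, f x, h.2, hf x hx⟩

theorem SearchProblem.HasPseudoDetQuantumPolyTime.exists_bitProblem {R : SearchProblem}
    (h : R.HasPseudoDetQuantumPolyTime) :
    ∃ f, (bitProblem R.dom f).InBQP ∧ R.PReducible (bitProblem R.dom f) := by
  obtain ⟨M, p, hp, f, hf⟩ := h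
  refine ⟨f, QuantumTM.inBQP_bitProblem hp fun x hx => (hf x hx).2,
    SearchProblem.pReducible_bitProblem (fun x hx => (hf x hx).1)
      (Polynomial.X + Polynomial.C (maxPushes M.tm) * p) fun x hx => ?_⟩
  have := QuantumTM.length_le_of_outputProb_pos
    (lt_of_lt_of_le (by norm_num : (0 : ℝ) < 2 / 3) (hf x hx).2)
  simpa using this

/-! ### A quantum machine that simulates an oracle machine with an oracle in BQP -/

namespace Simulator

open QuantumTM

/-- The additional stacks: a buffer, two unary copies of the length of the input, the clock, the
product that is being computed, two unary counters for repetitions, and the tally of the votes. -/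
inductive Aux
  | buf | len | len' | clk | prod | rep | rep' | tally
  deriving DecidableEq

instance : Fintype Aux :=
  ⟨{.buf, .len, .len', .clk, .prod, .rep, .rep', .tally}, fun k => by cases k <;> simp⟩

/-- The additional labels; the numbers count the multiplications that are still to be done. -/
inductive Label (k : ℕ)
  | read | restore | mul (j : Fin (k + 1)) | walk (j : Fin (k + 1)) | back (j : Fin (k + 1))
  | copy (j : Fin (k + 1)) | clear | check | load | fresh | vote | finish (b : Bool)

instance (k : ℕ) : Finite (Label k) :=
  Finite.of_injective (β := Bool × Fin 12 × Fin (k + 1))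
    (fun
      | .read => (false, 0, 0)
      | .restore => (false, 1, 0)
      | .clear => (false, 2, 0)
      | .check => (false, 3, 0)
      | .load => (false, 4, 0)
      | .fresh => (false, 5, 0)
      | .vote => (false, 6, 0)
      | .mul j => (false, 7, j)
      | .walk j => (false, 8, j)
      | .back j => (false, 9, j)
      | .copy j => (false, 10, j)
      | .finish b => (b, 11, 0)) <| by
    rintro (_ | _ | _ | _ | _ | _ | _ | _ | _ | _ | _ | _) (_ | _ | _ | _ | _ | _ | _ | _ | _ | _ | _ | _) <;>
      simp

variable (M : OracleTM) (N : QuantumTM) (k : ℕ)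

/-- The index type of the stacks. -/
abbrev Stack : Type := M.tm.K ⊕ N.tm.K ⊕ Aux

/-- The alphabets of the stacks. -/
abbrev Γ : Stack M N → Type
  | .inl k => M.tm.Γ k
  | .inr (.inl k) => N.tm.Γ k
  | .inr (.inr _) => Bool

/-- The labels. -/
abbrev Lab : Type := M.tm.Λ ⊕ N.tm.Λ ⊕ Label k

/-- The variables. -/
abbrev Var : Type := M.tm.σ × N.tm.σ × Option Bool × Option Bool

/-- The statements. -/
abbrev Stm : Type := TM2.Stmt (Γ M N) (Lab M N k) (Var M N)

variable {M N k}

/-- Read a symbol of an additional stack. -/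
def popAux (s : Aux) (q : Stm M N k) : Stm M N k :=
  .pop (.inr (.inr s)) (fun v o => (v.1, v.2.1, o, none)) q

/-- Write a symbol on an additional stack. -/
def pushAux (s : Aux) (b : Bool) (q : Stm M N k) : Stm M N k :=
  .push (.inr (.inr s)) (fun _ => b) q

/-- Go to an additional label. -/
def goAux (l : Label k) : Stm M N k := .goto fun _ => .inr (.inr l)

/-- Branch according to whether a symbol has been read. -/
def ifNone (q₁ q₂ : Stm M N k) : Stm M N k := .branch (fun v => v.2.2.1.isNone) q₁ q₂

/-- Pop one symbol from each of the given stacks of `N`. -/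
def popAll (ks : List N.tm.K) (q : Stm M N k) : Stm M N k :=
  ks.foldr (fun s q => .pop (.inr (.inl s))
    (fun v o => (v.1, v.2.1, if o.isSome then some true else v.2.2.1, none)) q) q

variable (M N k) in
open Classical in
/-- The program. -/
def program : Lab M N k → Stm M N k
  | .inl l =>
      popAux .clk <| ifNone .halt <|
        if l = M.query then goAux .clear else
          embedStmt (Γ' := Γ M N) Sum.inl (fun _ a => a) (fun _ a => a) Sum.inl Prod.fst
            (fun v w => (v, w.2)) .halt (M.tm.m l)
  | .inr (.inl l) =>
      embedStmt (Γ' := Γ M N) (fun s => .inr (.inl s)) (fun _ a => a) (fun _ a => a)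
        (fun l => .inr (.inl l)) (fun v => v.2.1) (fun v w => (w.1, v, w.2.2)) (goAux .vote)
        (N.tm.m l)
  | .inr (.inr .read) =>
      .pop (.inl M.tm.k₀) (fun v o => (v.1, v.2.1, o.map M.inputAlphabet, none)) <|
      ifNone (pushAux .len true <| pushAux .len true <| pushAux .clk true <|
          pushAux .rep true <| goAux .restore)
        (.push (.inr (.inr .buf)) (fun v => v.2.2.1 == some true) <| pushAux .len true <|
          goAux .read)
  | .inr (.inr .restore) =>
      popAux .buf <| ifNone (goAux (.mul (Fin.last k)))
        (.push (.inl M.tm.k₀) (fun v => M.inputAlphabet.symm (v.2.2.1 == some true)) <|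
          goAux .restore)
  | .inr (.inr (.mul j)) =>
      if j = 0 then .goto fun _ => .inl M.tm.main
      else popAux .clk <| ifNone (goAux (.copy j)) (goAux (.walk j))
  | .inr (.inr (.walk j)) =>
      popAux .len <| ifNone (goAux (.back j))
        (pushAux .len' true <| pushAux .prod true <| goAux (.walk j))
  | .inr (.inr (.back j)) =>
      popAux .len' <| ifNone (goAux (.mul j)) (pushAux .len true <| goAux (.back j))
  | .inr (.inr (.copy j)) =>
      popAux .prod <| ifNone (goAux (.mul ⟨j.1 - 1, by omega⟩))
        (pushAux .clk true <| pushAux .rep true <| goAux (.copy j))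
  | .inr (.inr .clear) =>
      .load (fun v => (v.1, v.2.1, none, none)) <|
      popAll (@Finset.univ _ N.tm.kFin).toList <|
      .pop (.inl M.queryStack) (fun v o => (v.1, v.2.1, v.2.2.1, o.map M.queryAlphabet)) <|
      .branch (fun v => v.2.2.2.isNone) (ifNone (goAux .check) (goAux .clear))
        (.push (.inr (.inr .buf)) (fun v => v.2.2.2 == some true) (goAux .clear))
  | .inr (.inr .check) =>
      popAux .rep <| ifNone
        (.peek (.inr (.inr .tally)) (fun v o => (v.1, v.2.1, o, none)) <|
          .goto fun v => .inr (.inr (.finish (v.2.2.1 == some true))))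
        (pushAux .rep' true <| goAux .load)
  | .inr (.inr .load) =>
      popAux .buf <| ifNone
        (.load (fun v => (v.1, N.tm.initialState, v.2.2)) <| goAux .fresh)
        (.push (.inl M.queryStack) (fun v => M.queryAlphabet.symm (v.2.2.1 == some true)) <|
          .push (.inr (.inl N.tm.k₀)) (fun v => N.inputAlphabet.symm (v.2.2.1 == some true)) <|
          goAux .load)
  | .inr (.inr .fresh) => .halt
  | .inr (.inr .vote) =>
      .pop (.inr (.inl N.tm.k₁)) (fun v o => (v.1, v.2.1, o.map N.outputAlphabet, none)) <|
      .pop (.inr (.inl N.tm.k₁)) (fun v o => (v.1, v.2.1, v.2.2.1, o.map N.outputAlphabet)) <|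
      .load (fun v => (v.1, v.2.1, some (v.2.2.1 == some true && v.2.2.2.isNone), none)) <|
      .pop (.inr (.inr .tally)) (fun v o => (v.1, v.2.1, v.2.2.1, o)) <|
      .branch (fun v => v.2.2.2.isNone)
        (.push (.inr (.inr .tally)) (fun v => v.2.2.1 == some true) <| goAux .clear)
        (.branch (fun v => v.2.2.2 == v.2.2.1)
          (.push (.inr (.inr .tally)) (fun v => v.2.2.1 == some true) <|
            .push (.inr (.inr .tally)) (fun v => v.2.2.1 == some true) <| goAux .clear)
          (goAux .clear))
  | .inr (.inr (.finish b)) =>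
      popAux .buf <|
      .pop (.inr (.inr .tally)) (fun v o => (v.1, v.2.1, v.2.2.1.or o, none)) <|
      .pop (.inr (.inr .rep')) (fun v o => (v.1, v.2.1, v.2.2.1, o)) <|
      .branch (fun v => v.2.2.2.isNone)
        (ifNone (.goto fun _ => .inl (if b then M.ansYes else M.ansNo)) (goAux (.finish b)))
        (pushAux .rep true <| goAux (.finish b))

variable (M N k)

/-- The classical control. -/
def control : FinTM2 :=
  letI := M.tm.kFin
  letI := N.tm.kFin
  letI := M.tm.ΛFin
  letI := N.tm.ΛFin
  letI := M.tm.σFin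
  letI := N.tm.σFin
  letI : Fintype (Label k) := Fintype.ofFinite _
  letI : Fintype (Γ M N (.inl M.tm.k₀)) := M.tm.Γk₀Fin
  { K := Stack M N
    k₀ := .inl M.tm.k₀
    k₁ := .inl M.tm.k₁
    Γ := Γ M N
    Λ := Lab M N k
    main := .inr (.inr .read)
    σ := Var M N
    initialState := (M.tm.initialState, N.tm.initialState, none, none)
    m := program M N k }

/-- The only quantum instruction at an additional label takes a fresh tape. -/
def auxInstr : Label k → Option QInstr
  | .fresh => some .fresh
  | _ => none

/-- The machine. -/
def machine : QuantumTM where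
  tm := control M N k
  inputAlphabet := M.inputAlphabet
  outputAlphabet := M.outputAlphabet
  instr := Sum.elim (fun _ => none) (Sum.elim N.instr (auxInstr k))
  next l b := match l with
    | .inl l => .inl l
    | .inr (.inl l) => .inr (.inl (N.next l b))
    | .inr (.inr _) => .inr (.inl N.tm.main)

variable {M N k}

/-- The stacks, given their contents. -/
def stk (SM : ∀ k, List (M.tm.Γ k)) (SN : ∀ k, List (N.tm.Γ k))
    (buf len len' clk prod rep rep' tally : List Bool) : ∀ k, List (Γ M N k)
  | .inl k => SM k
  | .inr (.inl k) => SN k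
  | .inr (.inr .buf) => buf
  | .inr (.inr .len) => len
  | .inr (.inr .len') => len'
  | .inr (.inr .clk) => clk
  | .inr (.inr .prod) => prod
  | .inr (.inr .rep) => rep
  | .inr (.inr .rep') => rep'
  | .inr (.inr .tally) => tally

section stk

variable {SM : ∀ k, List (M.tm.Γ k)} {SN : ∀ k, List (N.tm.Γ k)}
  {buf len len' clk prod rep rep' tally : List Bool}

@[simp] theorem stk_inl (s : M.tm.K) :
    stk SM SN buf len len' clk prod rep rep' tally (.inl s) = SM s := rfl
@[simp] theorem stk_inr_inl (s : N.tm.K) :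
    stk SM SN buf len len' clk prod rep rep' tally (.inr (.inl s)) = SN s := rfl
@[simp] theorem stk_buf :
    stk SM SN buf len len' clk prod rep rep' tally (.inr (.inr .buf)) = buf := rfl
@[simp] theorem stk_len :
    stk SM SN buf len len' clk prod rep rep' tally (.inr (.inr .len)) = len := rfl
@[simp] theorem stk_len' :
    stk SM SN buf len len' clk prod rep rep' tally (.inr (.inr .len')) = len' := rfl
@[simp] theorem stk_clk :
    stk SM SN buf len len' clk prod rep rep' tally (.inr (.inr .clk)) = clk := rfl
@[simp] theorem stk_prod :
    stk SM SN buf len len' clk prod rep rep' tally (.inr (.inr .prod)) = prod := rfl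
@[simp] theorem stk_rep :
    stk SM SN buf len len' clk prod rep rep' tally (.inr (.inr .rep)) = rep := rfl
@[simp] theorem stk_rep' :
    stk SM SN buf len len' clk prod rep rep' tally (.inr (.inr .rep')) = rep' := rfl
@[simp] theorem stk_tally :
    stk SM SN buf len len' clk prod rep rep' tally (.inr (.inr .tally)) = tally := rfl

@[simp] theorem update_inl (s : M.tm.K) (l : List (M.tm.Γ s)) :
    Function.update (stk SM SN buf len len' clk prod rep rep' tally) (.inl s) l =
      stk (Function.update SM s l) SN buf len len' clk prod rep rep' tally := by
  funext k'
  rcases k' with k' | k' | k'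
  · by_cases h : k' = s
    · subst h; simp
    · simp [h]
  · simp
  · cases k' <;> simp

@[simp] theorem update_inr_inl (s : N.tm.K) (l : List (N.tm.Γ s)) :
    Function.update (stk SM SN buf len len' clk prod rep rep' tally) (.inr (.inl s)) l =
      stk SM (Function.update SN s l) buf len len' clk prod rep rep' tally := by
  funext k'
  rcases k' with k' | k' | k'
  · simp
  · by_cases h : k' = s
    · subst h; simp
    · simp [h]
  · cases k' <;> simp

variable (l : List Bool)

@[simp] theorem update_buf :
    Function.update (stk SM SN buf len len' clk prod rep rep' tally) (.inr (.inr .buf)) l =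
      stk SM SN l len len' clk prod rep rep' tally := by
  funext k'; rcases k' with k' | k' | (_ | _) <;> simp
@[simp] theorem update_len :
    Function.update (stk SM SN buf len len' clk prod rep rep' tally) (.inr (.inr .len)) l =
      stk SM SN buf l len' clk prod rep rep' tally := by
  funext k'; rcases k' with k' | k' | (_ | _) <;> simp
@[simp] theorem update_len' :
    Function.update (stk SM SN buf len len' clk prod rep rep' tally) (.inr (.inr .len')) l =
      stk SM SN buf len l clk prod rep rep' tally := by
  funext k'; rcases k' with k' | k' | (_ | _) <;> simp
@[simp] theorem update_clk :
    Function.update (stk SM SN buf len len' clk prod rep rep' tally) (.inr (.inr .clk)) l =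
      stk SM SN buf len len' l prod rep rep' tally := by
  funext k'; rcases k' with k' | k' | (_ | _) <;> simp
@[simp] theorem update_prod :
    Function.update (stk SM SN buf len len' clk prod rep rep' tally) (.inr (.inr .prod)) l =
      stk SM SN buf len len' clk l rep rep' tally := by
  funext k'; rcases k' with k' | k' | (_ | _) <;> simp
@[simp] theorem update_rep :
    Function.update (stk SM SN buf len len' clk prod rep rep' tally) (.inr (.inr .rep)) l =
      stk SM SN buf len len' clk prod l rep' tally := by
  funext k'; rcases k' with k' | k' | (_ | _) <;> simp
@[simp] theorem update_rep' :
    Function.update (stk SM SN buf len len' clk prod rep rep' tally) (.inr (.inr .rep')) l =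
      stk SM SN buf len len' clk prod rep l tally := by
  funext k'; rcases k' with k' | k' | (_ | _) <;> simp
@[simp] theorem update_tally :
    Function.update (stk SM SN buf len len' clk prod rep rep' tally) (.inr (.inr .tally)) l =
      stk SM SN buf len len' clk prod rep rep' l := by
  funext k'; rcases k' with k' | k' | (_ | _) <;> simp

end stk

/-- A configuration. -/
def cfg (l : Option (Lab M N k)) (v : Var M N) (SM : ∀ k, List (M.tm.Γ k))
    (SN : ∀ k, List (N.tm.Γ k)) (buf : List Bool) (len len' clk prod rep rep' : ℕ)
    (tally : List Bool) (h : ℤ) (ψ : QState) : (machine M N k).Cfg :=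
  ⟨⟨l, v, stk SM SN buf (.replicate len true) (.replicate len' true)
    (.replicate clk true) (.replicate prod true) (.replicate rep true) (.replicate rep' true) tally⟩, h, ψ⟩

variable {SM : ∀ k, List (M.tm.Γ k)} {SN : ∀ k, List (N.tm.Γ k)} {buf : List Bool}
    {len len' clk prod rep rep' : ℕ} {tally : List Bool} {h : ℤ} {ψ : QState}
    {y : List Bool} {t : ℕ} {a : ℝ} {u : M.tm.σ} {r : N.tm.σ × Option Bool × Option Bool}

theorem yields_step {l : Lab M N k} (hl : (machine M N k).instr l = none)
    {v : Var M N}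
    (H : ∀ c : TM2.Cfg (Γ M N) (Lab M N k) (Var M N),
      TM2.stepAux (program M N k l) v (stk SM SN buf (.replicate len true) (.replicate len' true)
        (.replicate clk true) (.replicate prod true) (.replicate rep true) (.replicate rep' true) tally) = c →
      (machine M N k).Yields y t ⟨c, h, ψ⟩ a) :
    (machine M N k).Yields y (t + 1)
      (cfg (some l) v SM SN buf len len' clk prod rep rep' tally h ψ) a :=
  yields_classical (M := machine M N k) (l := l) hl (H _ rfl)

/-! #### Initialization -/

theorem yields_back {j : Fin (k + 1)} (H : ∀ r, (machine M N k).Yields y t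
      (cfg (some (.inr (.inr (.mul j)))) (u, r) SM SN buf (len' + len) 0 clk prod rep rep' tally
        h ψ) a) :
    (machine M N k).Yields y (t + len' + 1)
      (cfg (some (.inr (.inr (.back j)))) (u, r) SM SN buf len len' clk prod rep rep' tally h ψ)
      a := by
  induction len' generalizing len r with
  | zero =>
    refine yields_step rfl fun c hc => ?_
    simp [program, popAux, pushAux, goAux, ifNone] at hc
    subst hc
    rw [Nat.zero_add] at H
    exact H _
  | succ n ih =>
    refine yields_step rfl fun c hc => ?_
    simp [program, popAux, pushAux, goAux, ifNone, List.replicate_succ] at hc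
    subst hc
    refine ih (len := len + 1) fun r => ?_
    rw [show n + (len + 1) = n + 1 + len by omega]
    exact H r

theorem yields_walk {j : Fin (k + 1)} (H : ∀ r, (machine M N k).Yields y t
      (cfg (some (.inr (.inr (.back j)))) (u, r) SM SN buf 0 (len + len') clk (len + prod) rep rep'
        tally h ψ) a) :
    (machine M N k).Yields y (t + len + 1)
      (cfg (some (.inr (.inr (.walk j)))) (u, r) SM SN buf len len' clk prod rep rep' tally h ψ)
      a := by
  induction len generalizing len' prod r with
  | zero =>
    refine yields_step rfl fun c hc => ?_
    simp [program, popAux, pushAux, goAux, ifNone] at hc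
    subst hc
    rw [Nat.zero_add, Nat.zero_add] at H
    exact H _
  | succ n ih =>
    refine yields_step rfl fun c hc => ?_
    simp [program, popAux, pushAux, goAux, ifNone, List.replicate_succ] at hc
    subst hc
    refine ih (len' := len' + 1) (prod := prod + 1) fun r => ?_
    rw [show n + (len' + 1) = n + 1 + len' by omega, show n + (prod + 1) = n + 1 + prod by omega]
    exact H r

/-- Each symbol of the clock triggers one pass over `len` that adds `len` symbols to `prod`, and one
pass that restores `len`; both passes and the step before them take `2 * len + 3` steps. -/
theorem yields_mul {j : Fin (k + 1)} (hj : j ≠ 0) (H : ∀ r, (machine M N k).Yields y t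
      (cfg (some (.inr (.inr (.copy j)))) (u, r) SM SN buf len 0 0 (clk * len + prod) rep rep'
        tally h ψ) a) :
    (machine M N k).Yields y (t + clk * (2 * len + 3) + 1)
      (cfg (some (.inr (.inr (.mul j)))) (u, r) SM SN buf len 0 clk prod rep rep' tally h ψ)
      a := by
  induction clk generalizing prod r with
  | zero =>
    refine yields_step rfl fun c hc => ?_
    simp [program, popAux, goAux, ifNone, hj] at hc
    subst hc
    rw [Nat.zero_mul, Nat.zero_add] at H
    exact (H _).mono_time (by omega)
  | succ n ih =>
    refine Yields.mono_time (yields_step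
      (t := t + n * (2 * len + 3) + 1 + len + 1 + len + 1) rfl fun c hc => ?_) (by
        rw [Nat.add_mul]; omega)
    simp [program, popAux, goAux, ifNone, hj, List.replicate_succ] at hc
    subst hc
    refine yields_walk (len' := 0) fun r => yields_back (len' := len) (len := 0) fun r =>
      ih (prod := len + prod) fun r => ?_
    rw [show n * len + (len + prod) = (n + 1) * len + prod by ring]
    exact H r

/-- The product becomes the new clock and is also added to `rep`, which ensures that there will be
at least as many votes per query as clock ticks. -/
theorem yields_copy {j : Fin (k + 1)} (H : ∀ r, (machine M N k).Yields y t
      (cfg (some (.inr (.inr (.mul ⟨j.1 - 1, by omega⟩)))) (u, r) SM SN buf len len' (prod + clk) 0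
        (prod + rep) rep' tally h ψ) a) :
    (machine M N k).Yields y (t + prod + 1)
      (cfg (some (.inr (.inr (.copy j)))) (u, r) SM SN buf len len' clk prod rep rep' tally h ψ)
      a := by
  induction prod generalizing clk rep r with
  | zero =>
    refine yields_step rfl fun c hc => ?_
    simp [program, popAux, pushAux, goAux, ifNone] at hc
    subst hc
    rw [Nat.zero_add, Nat.zero_add] at H
    exact H _
  | succ n ih =>
    refine yields_step rfl fun c hc => ?_
    simp [program, popAux, pushAux, goAux, ifNone, List.replicate_succ] at hc
    subst hc
    refine ih (clk := clk + 1) (rep := rep + 1) fun r => ?_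
    rw [show n + (clk + 1) = n + 1 + clk by omega, show n + (rep + 1) = n + 1 + rep by omega]
    exact H r

/-- `n` multiplications by `m` raise the clock to `clk * m ^ n`. Since `rep` collects all
intermediate products, it is only bracketed: the last product gives the lower bound, and `n` times
the largest the upper one. -/
theorem yields_power {m : ℕ} (hm : 1 ≤ m) (n : ℕ) (j : Fin (k + 1)) (hj : j.1 = n)
    (hrep : clk ≤ rep) (H : ∀ r rep₁, clk * m ^ n ≤ rep₁ → rep₁ ≤ rep + n * (clk * m ^ n) →
      (machine M N k).Yields y t (cfg (some (.inl M.tm.main)) (u, r) SM SN buf m 0 (clk * m ^ n) 0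
        rep₁ rep' tally h ψ) a) :
    (machine M N k).Yields y (t + n * (clk * m ^ n * (2 * m + 4) + 2) + 1)
      (cfg (some (.inr (.inr (.mul j)))) (u, r) SM SN buf m 0 clk 0 rep rep' tally h ψ) a := by
  induction n generalizing j clk rep r with
  | zero =>
    have hj0 : j = 0 := Fin.ext hj
    refine Yields.mono_time (yields_step (t := t) rfl fun c hc => ?_) (by omega)
    simp [program, hj0] at hc
    subst hc
    have := H r rep (by simpa using hrep) (by simp)
    rw [pow_zero, Nat.mul_one] at this
    exact this
  | succ n ih =>
    have hj0 : j ≠ 0 := fun h => by rw [h] at hj; simp at hj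
    have hT : clk * m ^ (n + 1) = clk * m * m ^ n := by ring
    have h1 : clk ≤ clk * m ^ (n + 1) := Nat.le_mul_of_pos_right _ (by positivity)
    have h2 : clk * m ≤ clk * m ^ (n + 1) := by
      rw [hT]; exact Nat.le_mul_of_pos_right _ (by positivity)
    -- As `m ≥ 1`, this final clock bounds every intermediate one and hence the cost of each
    -- multiplication.
    set T := clk * m ^ (n + 1) with hTdef
    refine Yields.mono_time (yields_mul (clk := clk) (prod := 0) hj0 fun r =>
      yields_copy (t := t + n * (T * (2 * m + 4) + 2) + 1) fun r => ?_) ?_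
    · rw [Nat.add_zero, Nat.add_zero, hT]
      refine ih (clk := clk * m) (rep := clk * m + rep) ⟨j.1 - 1, by omega⟩ (by simp [hj])
        (by omega) fun r rep₁ hr1 hr2 => ?_
      rw [← hT] at hr1 hr2 ⊢
      refine H r rep₁ hr1 (hr2.trans ?_)
      rw [Nat.add_mul]
      omega
    · have h3 : clk * (2 * m + 3) ≤ T * (2 * m + 3) := Nat.mul_le_mul_right _ h1
      have h4 : T * (2 * m + 4) = T * (2 * m + 3) + T := by ring
      rw [Nat.add_mul n 1]
      omega

theorem yields_restore (l : List Bool) (H : ∀ r, (machine M N k).Yields y t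
      (cfg (some (.inr (.inr (.mul (Fin.last k))))) (u, r)
        (inputStk M.tm ((buf.reverse ++ l).map M.inputAlphabet.symm)) SN [] len len' clk prod rep
        rep' tally h ψ) a) :
    (machine M N k).Yields y (t + buf.length + 1)
      (cfg (some (.inr (.inr .restore))) (u, r) (inputStk M.tm (l.map M.inputAlphabet.symm)) SN buf
        len len' clk prod rep rep' tally h ψ) a := by
  induction buf generalizing l r with
  | nil =>
    refine yields_step rfl fun c hc => ?_
    simp [program, popAux, goAux, ifNone] at hc
    subst hc
    exact H _
  | cons b buf ih =>
    refine yields_step rfl fun c hc => ?_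
    simp [program, popAux, goAux, ifNone] at hc
    subst hc
    refine ih (b :: l) fun r => ?_
    have := H r
    simpa only [List.reverse_cons, List.append_assoc, List.singleton_append] using this

theorem yields_read (l : List Bool) (H : ∀ r, (machine M N k).Yields y t
      (cfg (some (.inr (.inr .restore))) (u, r) (inputStk M.tm ([].map M.inputAlphabet.symm)) SN
        (l.reverse ++ buf) (l.length + len + 2) len' (clk + 1) prod (rep + 1) rep' tally h ψ) a) :
    (machine M N k).Yields y (t + l.length + 1)
      (cfg (some (.inr (.inr .read))) (u, r) (inputStk M.tm (l.map M.inputAlphabet.symm)) SN buf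
        len len' clk prod rep rep' tally h ψ) a := by
  induction l generalizing buf len r with
  | nil =>
    refine yields_step rfl fun c hc => ?_
    simp [program, pushAux, goAux, ifNone] at hc
    subst hc
    rw [List.length_nil, Nat.zero_add] at H
    exact H _
  | cons b l ih =>
    refine yields_step rfl fun c hc => ?_
    simp [program, pushAux, goAux, ifNone] at hc
    subst hc
    refine ih (buf := b :: buf) (len := len + 1) fun r => ?_
    have := H r
    rw [show l.length + (len + 1) + 2 = (b :: l).length + len + 2 by
      rw [List.length_cons]; omega]
    simpa only [List.reverse_cons, List.append_assoc, List.singleton_append] using this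

/-! #### Clearing the stacks between runs of the oracle machine -/

/-- The symbol flag can stay `none` only if nothing was popped, so the program can tell when all
listed stacks were empty. The exact new contents are not needed, only that each stack has shrunk. -/
theorem stepAux_popAll (ks : List N.tm.K) (q : Stm M N k) (w : N.tm.σ) (r₁ r₂ : Option Bool)
    (SN : ∀ k, List (N.tm.Γ k)) (b₁ b₂ b₃ b₄ b₅ b₆ b₇ b₈ : List Bool) :
    ∃ r₁' r₂' SN', TM2.stepAux (popAll ks q) (u, w, r₁, r₂) (stk SM SN b₁ b₂ b₃ b₄ b₅ b₆ b₇ b₈) =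
        TM2.stepAux q (u, w, r₁', r₂') (stk SM SN' b₁ b₂ b₃ b₄ b₅ b₆ b₇ b₈) ∧
      (∀ s, (SN' s).length ≤ (SN s).length) ∧
      (∀ s ∈ ks, (SN' s).length ≤ (SN s).length - 1) ∧
      (r₁' = none → r₁ = none ∧ ∀ s ∈ ks, SN s = []) ∧ ((∀ s, SN s = []) → r₁' = r₁) := by
  induction ks generalizing r₁ r₂ SN with
  | nil => exact ⟨r₁, r₂, SN, rfl, fun _ => le_rfl, by simp, by simp, fun _ => rfl⟩
  | cons s ks ih =>
    obtain ⟨r₁', r₂', SN', h1, h2, h3, h4, h5⟩ :=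
      ih (if (SN s).head?.isSome then some true else r₁) none (Function.update SN s (SN s).tail)
    have hlen : ∀ s', (Function.update SN s (SN s).tail s').length ≤ (SN s').length := fun s' => by
      by_cases hs : s' = s
      · subst hs; simp
      · simp [hs]
    refine ⟨r₁', r₂', SN', ?_, fun s' => (h2 s').trans (hlen s'), ?_, ?_, ?_⟩
    · rw [← h1]
      simp [popAll]
    · intro s' hs'
      rcases List.mem_cons.mp hs' with rfl | hs'
      · exact (h2 s').trans (by simp)
      · exact (h3 s' hs').trans (Nat.sub_le_sub_right (hlen s') 1)
    · intro hr
      obtain ⟨h6, h7⟩ := h4 hr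
      have hs : SN s = [] := by
        rcases hS : SN s with _ | ⟨b, l⟩
        · rfl
        · rw [hS] at h6; simp at h6
      have hu : Function.update SN s (SN s).tail = SN := by
        rw [hs, List.tail_nil, ← hs, Function.update_eq_self]
      rw [hu] at h7
      refine ⟨by simpa [hs] using h6, fun s' hs' => ?_⟩
      rcases List.mem_cons.mp hs' with rfl | hs'
      · exact hs
      · exact h7 s' hs'
    · intro hS
      have hu : Function.update SN s (SN s).tail = SN := by
        rw [hS s, List.tail_nil, ← hS s, Function.update_eq_self]
      rw [hu] at h5
      rw [h5 hS, hS s]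
      rfl

/-- Each round shortens all stacks of `N` and the query at once, so the largest height bounds the
number of rounds. The query is saved in reverse on `buf`. -/
theorem yields_clear {n : ℕ} (l : List Bool) (hl : l.length ≤ n) (hSN : ∀ s, (SN s).length ≤ n)
    (H : ∀ r, (machine M N k).Yields y t
      (cfg (some (.inr (.inr .check))) (u, r) (Function.update SM M.queryStack []) (fun _ => [])
        (l.reverse ++ buf) len len' clk prod rep rep' tally h ψ) a) :
    (machine M N k).Yields y (t + n + 1)
      (cfg (some (.inr (.inr .clear))) (u, r)
        (Function.update SM M.queryStack (l.map M.queryAlphabet.symm)) SN buf len len' clk prod rep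
        rep' tally h ψ) a := by
  induction n generalizing l buf SN r with
  | zero =>
    have hl0 : l = [] := List.length_eq_zero_iff.mp (by omega)
    have hS0 : SN = fun _ => [] := funext fun s => List.length_eq_zero_iff.mp (by
      have := hSN s; omega)
    subst hl0 hS0
    refine yields_step rfl fun c hc => ?_
    obtain ⟨r₁', r₂', SN', h1, h2, -, -, h5⟩ := stepAux_popAll (M := M) (k := k) (u := u)
      (SM := Function.update SM M.queryStack ([].map M.queryAlphabet.symm))
      (@Finset.univ _ N.tm.kFin).toList
      (.pop (.inl M.queryStack) (fun v o => (v.1, v.2.1, v.2.2.1, o.map M.queryAlphabet)) <|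
      .branch (fun v => v.2.2.2.isNone) (ifNone (goAux .check) (goAux .clear))
        (.push (.inr (.inr .buf)) (fun v => v.2.2.2 == some true) (goAux .clear)))
      r.1 none none (fun _ => []) buf (.replicate len true) (.replicate len' true)
      (.replicate clk true) (.replicate prod true) (.replicate rep true) (.replicate rep' true)
      tally
    -- With all stacks empty the flag keeps the value `none` set by the initial load, so this round
    -- is the one that leaves the loop.
    rw [program, TM2.stepAux, h1, h5 fun _ => rfl] at hc
    have hS' : SN' = fun _ => [] := funext fun s => List.length_eq_zero_iff.mp (by
      have := h2 s; simpa using this)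
    subst hS'
    simp [ifNone, goAux] at hc
    subst hc
    exact H _
  | succ n ih =>
    refine yields_step rfl fun c hc => ?_
    obtain ⟨r₁', r₂', SN', h1, h2, h3, h4, -⟩ := stepAux_popAll (M := M) (k := k) (u := u)
      (SM := Function.update SM M.queryStack (l.map M.queryAlphabet.symm))
      (@Finset.univ _ N.tm.kFin).toList
      (.pop (.inl M.queryStack) (fun v o => (v.1, v.2.1, v.2.2.1, o.map M.queryAlphabet)) <|
      .branch (fun v => v.2.2.2.isNone) (ifNone (goAux .check) (goAux .clear))
        (.push (.inr (.inr .buf)) (fun v => v.2.2.2 == some true) (goAux .clear)))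
      r.1 none none SN buf (.replicate len true) (.replicate len' true)
      (.replicate clk true) (.replicate prod true) (.replicate rep true) (.replicate rep' true)
      tally
    rw [program, TM2.stepAux, h1] at hc
    let := N.tm.kFin
    have h3' : ∀ s, (SN' s).length ≤ n := fun s =>
      (h3 s (Finset.mem_toList.mpr (Finset.mem_univ s))).trans (by have := hSN s; omega)
    cases l with
    | cons b l =>
      simp [ifNone, goAux] at hc
      subst hc
      refine ih (buf := b :: buf) l (by simpa using hl) h3' fun r => ?_
      simpa only [List.reverse_cons, List.append_assoc, List.singleton_append] using H r
    | nil =>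
      cases r₁' with
      | none =>
        have hS' : SN' = fun _ => [] := funext fun s => List.length_eq_zero_iff.mp (by
          have h5 := h2 s
          rw [(h4 rfl).2 s (Finset.mem_toList.mpr (Finset.mem_univ s))] at h5
          simpa using h5)
        subst hS'
        simp [ifNone, goAux] at hc
        subst hc
        exact (H _).mono_time (by omega)
      | some b =>
        simp [ifNone, goAux] at hc
        subst hc
        exact ih [] (by simp) h3' H

/-- Three stacks are emptied in parallel, whence the maximum `n`. Moving `rep'` back to `rep`
restores the number of votes for the next query. -/
theorem yields_finish {b : Bool} {n : ℕ} (hbuf : buf.length ≤ n) (hrep : rep' ≤ n)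
    (htally : tally.length ≤ n) (H : ∀ r, (machine M N k).Yields y t
      (cfg (some (.inl (if b then M.ansYes else M.ansNo))) (u, r) SM SN [] len len' clk prod
        (rep' + rep) 0 [] h ψ) a) :
    (machine M N k).Yields y (t + n + 1)
      (cfg (some (.inr (.inr (.finish b)))) (u, r) SM SN buf len len' clk prod rep rep' tally h ψ)
      a := by
  induction n generalizing buf rep rep' tally r with
  | zero =>
    have h1 : buf = [] := List.length_eq_zero_iff.mp (by omega)
    have h2 : tally = [] := List.length_eq_zero_iff.mp (by omega)
    have h3 : rep' = 0 := by omega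
    subst h1 h2 h3
    refine yields_step rfl fun c hc => ?_
    simp [program, popAux, pushAux, goAux, ifNone] at hc
    subst hc
    rw [Nat.zero_add] at H
    exact H _
  | succ n ih =>
    refine yields_step rfl fun c hc => ?_
    have hb : buf.tail.length ≤ n := by simp; omega
    have ht : tally.tail.length ≤ n := by simp; omega
    cases rep' with
    | succ m =>
      simp [program, popAux, pushAux, goAux, ifNone, List.replicate_succ] at hc
      subst hc
      refine ih (rep := rep + 1) hb (by omega) ht fun r => ?_
      rw [show m + (rep + 1) = m + 1 + rep by omega]
      exact H r
    | zero =>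
      cases buf with
      | cons c' buf =>
        simp [program, popAux, pushAux, goAux, ifNone] at hc
        subst hc
        exact ih (rep' := 0) hb (by omega) ht H
      | nil =>
        cases tally with
        | cons c' tally =>
          simp [program, popAux, pushAux, goAux, ifNone] at hc
          subst hc
          exact ih (rep' := 0) (buf := []) (by simp) (by omega) ht H
        | nil =>
          simp [program, popAux, pushAux, goAux, ifNone] at hc
          subst hc
          rw [Nat.zero_add] at H
          exact (H _).mono_time (by omega)

/-! #### Majority votes -/

/-- The effect of a vote on the tally, a list of equal votes. -/
def bump (b : Bool) : List Bool → List Bool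
  | [] => [b]
  | c :: W => if c = b then b :: b :: W else W

theorem length_bump_le (b : Bool) (W : List Bool) : (bump b W).length ≤ W.length + 1 := by
  cases W with
  | nil => simp [bump]
  | cons c W =>
    rw [bump]
    split_ifs <;> simp
    omega

/-- The surplus of positive votes. -/
def score (W : List Bool) : ℝ := (W.map fun b => if b then (1 : ℝ) else -1).sum

theorem score_bump (b : Bool) (W : List Bool) :
    score (bump b W) = score W + if b then 1 else -1 := by
  cases W with
  | nil => simp [bump, score]
  | cons c W => cases b <;> cases c <;> simp [bump, score] <;> ring

/-- Opposite votes cancel, so the tally is a unary signed counter; its top symbol then shows the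
sign of the score. -/
theorem exists_bump_eq_replicate {W : List Bool} (b : Bool)
    (hW : ∃ n c, W = List.replicate n c) : ∃ n c, bump b W = List.replicate n c := by
  obtain ⟨n, c, rfl⟩ := hW
  cases n with
  | zero => exact ⟨1, b, rfl⟩
  | succ n =>
    rw [List.replicate_succ, bump]
    split_ifs with h
    · exact ⟨n + 2, b, by rw [h]; rfl⟩
    · exact ⟨n, c, rfl⟩

theorem score_replicate (n : ℕ) (b : Bool) :
    score (List.replicate n b) = if b then (n : ℝ) else -n := by
  cases b <;> simp [score]

/-- The expected value when `j` more votes are taken, positive with probability `P`, if a positive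
majority is worth `A` and a negative majority is worth `B`. -/
def voteValue (P A B : ℝ) : ℕ → List Bool → ℝ
  | 0, W => if W.head? == some true then A else B
  | j + 1, W => P * voteValue P A B j (bump true W) + (1 - P) * voteValue P A B j (bump false W)

theorem voteValue_nonneg {P A B : ℝ} (hP : 0 ≤ P) (hP' : P ≤ 1) (hA : 0 ≤ A) (hB : 0 ≤ B) (j : ℕ)
    (W : List Bool) : 0 ≤ voteValue P A B j W := by
  induction j generalizing W with
  | zero =>
    rw [voteValue]
    split_ifs
    exacts [hA, hB]
  | succ j ih =>
    have := ih (bump true W)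
    have := ih (bump false W)
    have : 0 ≤ 1 - P := by linarith
    rw [voteValue]
    positivity

/-- Chebyshev's inequality for votes. -/
theorem le_voteValue {P A B a m : ℝ} (hP : 0 ≤ P) (hP' : P ≤ 1) (hm : m ≠ 0)
    (hpos : ∀ s : ℝ, 0 < s → a * (1 - (s - m) ^ 2 / m ^ 2) ≤ A)
    (hneg : ∀ s : ℝ, s ≤ 0 → a * (1 - (s - m) ^ 2 / m ^ 2) ≤ B) (j : ℕ) (W : List Bool)
    (hW : ∃ n c, W = List.replicate n c) :
    a * (1 - ((score W + j * (2 * P - 1) - m) ^ 2 + j * (1 - (2 * P - 1) ^ 2)) / m ^ 2) ≤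
      voteValue P A B j W := by
  induction j generalizing W with
  | zero =>
    -- Without votes left, the quadratic in the score is a lower bound for the payoff on either side
    -- of zero. An empty tally counts as negative.
    obtain ⟨n, c, rfl⟩ := hW
    rw [voteValue, score_replicate]
    simp only [Nat.cast_zero, zero_mul, add_zero]
    cases n with
    | zero => simpa using hneg 0 le_rfl
    | succ n =>
      cases c
      · exact hneg _ (neg_nonpos.mpr (Nat.cast_nonneg _))
      · exact hpos _ (Nat.cast_pos.mpr n.succ_pos)
  | succ j ih =>
    have h1 := ih _ (exists_bump_eq_replicate true hW)
    have h2 := ih _ (exists_bump_eq_replicate false hW)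
    rw [score_bump] at h1 h2
    rw [voteValue]
    -- The bracket is the second moment about `m` of the final score: squared bias plus a variance
    -- of `1 - (2P - 1)²` per vote. Averaging over one vote therefore gives an exact identity.
    refine le_trans (le_of_eq ?_) (add_le_add (mul_le_mul_of_nonneg_left h1 hP)
      (mul_le_mul_of_nonneg_left h2 (by linarith : 0 ≤ 1 - P)))
    push_cast
    simp only [if_true]
    field_simp
    ring

/-- Choosing `m` as the mean removes the bias. What remains is the variance divided by the squared
mean, at most `9 / n` because a vote has mean at least 1/3 in absolute value. -/
theorem one_sub_le_voteValue {P A B a m : ℝ} {n : ℕ} (hn : 0 < n) (hP : 0 ≤ P) (hP' : P ≤ 1)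
    (ha : 0 ≤ a) (hm : m = n * (2 * P - 1)) (hμ : 1 / 9 ≤ (2 * P - 1) ^ 2)
    (hpos : ∀ s : ℝ, 0 < s → a * (1 - (s - m) ^ 2 / m ^ 2) ≤ A)
    (hneg : ∀ s : ℝ, s ≤ 0 → a * (1 - (s - m) ^ 2 / m ^ 2) ≤ B) :
    (1 - 9 / n) * a ≤ voteValue P A B n [] := by
  have hn' : (0 : ℝ) < n := by exact_mod_cast hn
  have hμ0 : 2 * P - 1 ≠ 0 := fun h => by rw [h] at hμ; norm_num at hμ
  have hm0 : m ≠ 0 := by rw [hm]; exact mul_ne_zero hn'.ne' hμ0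
  have := le_voteValue hP hP' hm0 hpos hneg n [] ⟨0, true, rfl⟩
  refine le_trans ?_ this
  rw [mul_comm]
  refine mul_le_mul_of_nonneg_left ?_ ha
  have h0 : score [] + n * (2 * P - 1) - m = 0 := by rw [hm]; simp [score]
  rw [h0, hm, sub_le_sub_iff_left]
  set μ := 2 * P - 1
  have hμp : 0 < μ ^ 2 := by positivity
  rw [div_le_div_iff₀ (by positivity) hn']
  have : (n : ℝ) * n * 1 ≤ n * n * (9 * μ ^ 2) := by
    refine mul_le_mul_of_nonneg_left (by linarith) (by positivity)
  nlinarith [mul_pos (mul_pos hn' hn') hμp]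

/-- For `s ≤ 0 < m` the distance from `s` to `m` is at least `m`, so the quadratic is nonpositive
there; elsewhere it is at most 1. -/
theorem voteValue_of_two_thirds_le {P a : ℝ} {n : ℕ} (hn : 0 < n) (hP : 2 / 3 ≤ P) (hP' : P ≤ 1)
    (ha : 0 ≤ a) : (1 - 9 / n) * a ≤ voteValue P a 0 n [] := by
  have hm : 0 < (n : ℝ) * (2 * P - 1) := mul_pos (by exact_mod_cast hn) (by linarith)
  refine one_sub_le_voteValue hn (by linarith) hP' ha rfl (by nlinarith) (fun s _ => ?_)
    (fun s hs => ?_)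
  · exact mul_le_of_le_one_right ha (sub_le_self _ (by positivity))
  · refine mul_nonpos_of_nonneg_of_nonpos ha ?_
    rw [sub_nonpos, one_le_div (by positivity)]
    nlinarith

theorem voteValue_of_le_third {P a : ℝ} {n : ℕ} (hn : 0 < n) (hP : 0 ≤ P) (hP' : P ≤ 1 / 3)
    (ha : 0 ≤ a) : (1 - 9 / n) * a ≤ voteValue P 0 a n [] := by
  have hm : (n : ℝ) * (2 * P - 1) < 0 :=
    mul_neg_of_pos_of_neg (by exact_mod_cast hn) (by linarith)
  refine one_sub_le_voteValue hn hP (by linarith) ha rfl (by nlinarith) (fun s hs => ?_)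
    (fun s _ => ?_)
  · refine mul_nonpos_of_nonneg_of_nonpos ha ?_
    rw [sub_nonpos, one_le_div (by nlinarith)]
    nlinarith
  · exact mul_le_of_le_one_right ha (sub_le_self _ (by positivity))

/-! #### Runs of the oracle machine -/

/-- A vote is positive exactly when the output is `[true]`, and two pops decide this. Any other
output, even a malformed one, is a negative vote. -/
theorem yields_vote (H : ∀ r SN', (∀ s, (SN' s).length ≤ (SN s).length) →
      (machine M N k).Yields y t (cfg (some (.inr (.inr .clear))) (u, r) SM SN' buf len len' clk
        prod rep rep' (bump (decide ((SN N.tm.k₁).map N.outputAlphabet = [true])) tally) h ψ) a) :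
    (machine M N k).Yields y (t + 1)
      (cfg (some (.inr (.inr .vote))) (u, r) SM SN buf len len' clk prod rep rep' tally h ψ) a := by
  refine yields_step rfl fun c hc => ?_
  have hlen : ∀ l : List (N.tm.Γ N.tm.k₁), l.length ≤ (SN N.tm.k₁).length →
      ∀ s, (Function.update SN N.tm.k₁ l s).length ≤ (SN s).length := fun l hl s => by
    by_cases hs : s = N.tm.k₁
    · subst hs; simpa using hl
    · simp [hs]
  obtain ⟨b, hb⟩ : ∃ b, b = decide ((SN N.tm.k₁).map N.outputAlphabet = [true]) := ⟨_, rfl⟩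
  rw [← hb] at H
  rcases hS : SN N.tm.k₁ with _ | ⟨g, _ | ⟨g', l⟩⟩
  · have hT := hlen [] (by simp)
    simp [hS] at hb
    subst hb
    rcases tally with _ | ⟨_ | _, W⟩ <;>
    · simp [program, goAux, hS] at hc
      subst hc
      exact H _ _ hT
  · have hT := hlen [] (by simp)
    cases hg : N.outputAlphabet g <;>
    · simp [hS, hg] at hb
      subst hb
      rcases tally with _ | ⟨_ | _, W⟩ <;>
      · simp [program, goAux, hS, hg] at hc
        subst hc
        exact H _ _ hT
  · have hT := hlen l (by rw [hS, List.length_cons, List.length_cons]; omega)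
    simp [hS] at hb
    subst hb
    rcases tally with _ | ⟨_ | _, W⟩ <;>
    · simp [program, goAux, hS] at hc
      subst hc
      exact H _ _ hT

theorem yields_load (l : List Bool) (H : ∀ r₂, (machine M N k).Yields y t
      (cfg (some (.inr (.inr .fresh))) (u, N.tm.initialState, r₂)
        (Function.update SM M.queryStack ((buf.reverse ++ l).map M.queryAlphabet.symm))
        (inputStk N.tm ((buf.reverse ++ l).map N.inputAlphabet.symm)) [] len len' clk prod rep
        rep' tally h ψ) a) :
    (machine M N k).Yields y (t + buf.length + 1)
      (cfg (some (.inr (.inr .load))) (u, r)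
        (Function.update SM M.queryStack (l.map M.queryAlphabet.symm))
        (inputStk N.tm (l.map N.inputAlphabet.symm)) buf len len' clk prod rep rep' tally h ψ)
      a := by
  induction buf generalizing l r with
  | nil =>
    refine yields_step rfl fun c hc => ?_
    simp [program, popAux, goAux, ifNone] at hc
    subst hc
    exact H _
  | cons b buf ih =>
    refine yields_step rfl fun c hc => ?_
    simp [program, popAux, goAux, ifNone] at hc
    subst hc
    refine ih (b :: l) fun r => ?_
    have := H r
    simpa only [List.reverse_cons, List.append_assoc, List.singleton_append] using this

/-- The configuration that corresponds to a configuration of `N`. -/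
def embed (u : M.tm.σ) (r₂ : Option Bool × Option Bool) (SM : ∀ k, List (M.tm.Γ k))
    (buf : List Bool) (len len' clk prod rep rep' : ℕ) (tally : List Bool) (c : N.Cfg) :
    (machine M N k).Cfg :=
  cfg (some (c.classical.l.elim (.inr (.inr .vote)) fun l => .inr (.inl l)))
    (u, c.classical.var, r₂) SM c.classical.stk buf len len' clk prod rep rep' tally c.head c.state

theorem step_embed (r₂ : Option Bool × Option Bool) (c : N.Cfg) (hc : c.classical.l ≠ none) :
    (machine M N k).step (embed u r₂ SM buf len len' clk prod rep rep' tally c) =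
      (N.step c).map (embed u r₂ SM buf len len' clk prod rep rep' tally) := by
  obtain ⟨⟨l, v, S⟩, h, ψ⟩ := c
  obtain ⟨l, rfl⟩ := Option.ne_none_iff_exists'.mp hc
  cases hl : N.instr l with
  | none =>
    rw [step_classical hl, embed, cfg]
    refine (step_classical (M := machine M N k) (l := .inr (.inl l)) hl _ _ h ψ).trans ?_
    have := stepAux_embedStmt (Γ' := Γ M N) (ι := fun s => .inr (.inl s)) (e := fun _ a => a)
      (ei := fun _ a => a) (lab := (fun l => .inr (.inl l) : _ → Lab M N k))
      (get := fun v : Var M N => v.2.1) (set := fun v w => (w.1, v, w.2.2)) (H := goAux .vote)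
      (fun v => (u, v, r₂))
      (fun S => stk SM S buf (.replicate len true) (.replicate len' true) (.replicate clk true)
        (.replicate prod true) (.replicate rep true) (.replicate rep' true) tally)
      (fun _ _ => rfl) (fun _ => rfl) (fun _ _ => rfl) (fun _ _ => (List.map_id _).symm)
      (fun _ _ _ => by simp) (N.tm.m l) v S
    rw [List.map_singleton]
    refine congrArg (fun c => [(⟨c, h, ψ⟩ : (machine M N k).Cfg)]) (this.trans ?_)
    rcases TM2.stepAux (N.tm.m l) v S with ⟨_ | l', w, T⟩ <;> rfl
  | some i =>
    rw [step_quantum hl, embed, cfg, List.map_map]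
    exact step_quantum (M := machine M N k) (l := .inr (.inl l)) hl _ _ h ψ

theorem yields_fresh {w : N.tm.σ} {r₂ : Option Bool × Option Bool}
    (H : (machine M N k).Yields y t (cfg (some (.inr (.inl N.tm.main))) (u, w, r₂) SM SN buf len
      len' clk prod rep rep' tally 0 (((Real.sqrt ψ.normSq : ℝ) : ℂ) • QState.zero)) a) :
    (machine M N k).Yields y (t + 1)
      (cfg (some (.inr (.inr .fresh))) (u, w, r₂) SM SN buf len len' clk prod rep rep' tally h ψ)
      a := by
  have hs : (machine M N k).step (cfg (some (.inr (.inr .fresh))) (u, w, r₂) SM SN buf len len'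
      clk prod rep rep' tally h ψ) = [cfg (some (.inr (.inl N.tm.main))) (u, w, r₂) SM SN buf len
      len' clk prod rep rep' tally 0 (((Real.sqrt ψ.normSq : ℝ) : ℂ) • QState.zero)] :=
    step_quantum (M := machine M N k) (l := .inr (.inr .fresh)) (i := .fresh) rfl _ _ h ψ
  have := yields_of_step (y := y) (t := t) (fun _ => a) (by rw [hs]; simpa using H)
  rw [hs] at this
  simpa using this

/-- On branches of positive weight the output stack is the output, so the weights split into those
that output `z` and the rest. Branches without weight may still be running, but contribute nothing.
-/
theorem sum_map_select {c : N.Cfg} {T : ℕ}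
    (hhalt : ∀ d ∈ N.runFrom c T, d.state.normSq ≠ 0 → d.classical.l = none) (z : List Bool)
    (A B : ℝ) :
    ((N.runFrom c T).map fun d => d.state.normSq *
      if (d.classical.stk N.tm.k₁).map N.outputAlphabet = z then A else B).sum =
      ((N.runFrom c T).map (N.weight z)).sum * A +
        (c.state.normSq - ((N.runFrom c T).map (N.weight z)).sum) * B := by
  have h1 : ∀ d ∈ N.runFrom c T, (d.state.normSq *
      if (d.classical.stk N.tm.k₁).map N.outputAlphabet = z then A else B) =
      N.weight z d * (A - B) + d.state.normSq * B := fun d hd => by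
    by_cases h0 : d.state.normSq = 0
    · rw [weight_eq_zero h0, h0]; ring
    · have ho : N.output d = some ((d.classical.stk N.tm.k₁).map N.outputAlphabet) := by
        rw [output, if_pos (by simp [hhalt d hd h0])]
      have hw : N.weight z d = if (d.classical.stk N.tm.k₁).map N.outputAlphabet = z then
          d.state.normSq else 0 := by
        simp only [weight, ho, Option.some.injEq]
      rw [hw]
      split_ifs <;> ring
  rw [List.map_congr_left h1, List.sum_map_add, List.sum_map_mul_right, List.sum_map_mul_right,
    sum_normSq_runFrom]
  ring

/-- `fresh` leaves exactly the initial state of `N` scaled by the square root of the weight, so the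
output distribution of `N` is that of a run from scratch, whatever happened before. -/
theorem yields_run {p : Polynomial ℕ} (hp : N.RunsInTime p) (q : List Bool)
    {r₂ : Option Bool × Option Bool} {A B : ℝ}
    (H : ∀ w SN h ψ,
      (∀ s, (SN s).length ≤ q.length + maxPushes N.tm * p.eval q.length) →
      (machine M N k).Yields y t (cfg (some (.inr (.inr .vote))) (u, w, r₂) SM SN buf len len' clk
        prod rep rep' tally h ψ)
        (ψ.normSq * if (SN N.tm.k₁).map N.outputAlphabet = [true] then A else B)) :
    (machine M N k).Yields y (p.eval q.length + t + 1)
      (cfg (some (.inr (.inr .fresh))) (u, N.tm.initialState, r₂) SM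
        (inputStk N.tm (q.map N.inputAlphabet.symm)) buf len len' clk prod rep rep' tally h ψ)
      (ψ.normSq * (N.outputProb q (p.eval q.length) [true] * A +
        (1 - N.outputProb q (p.eval q.length) [true]) * B)) := by
  refine yields_fresh ?_
  have ha : 0 ≤ Real.sqrt ψ.normSq := Real.sqrt_nonneg _
  have hrun := runFrom_scale ha (N.init q) (p.eval q.length)
  have hhalt : ∀ d ∈ N.runFrom ((N.init q).scale (Real.sqrt ψ.normSq)) (p.eval q.length),
      d.state.normSq ≠ 0 → d.classical.l = none := fun d hd hn => by
    rw [hrun] at hd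
    obtain ⟨e, he, rfl⟩ := List.mem_map.mp hd
    rw [normSq_scale] at hn
    exact hp q e (by rwa [run_eq_runFrom]) (right_ne_zero_of_mul hn)
  have := yields_of_simulation (y := y) (N := N)
    (embed (k := k) u r₂ SM buf len len' clk prod rep rep' tally)
    (step_embed r₂) (fun _ => rfl)
    (fun d => d.state.normSq *
      if (d.classical.stk N.tm.k₁).map N.outputAlphabet = [true] then A else B)
    (fun d hd => by rw [hd, zero_mul]) t (p.eval q.length) _ hhalt (fun d hd hl => by
      have hlen : ∀ s, (d.classical.stk s).length ≤
          q.length + maxPushes N.tm * p.eval q.length := fun s => by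
        refine (length_runFrom_le hd s).trans (Nat.add_le_add_right ?_ _)
        have := length_inputStk_le N.tm (q.map N.inputAlphabet.symm) s
        rwa [List.length_map] at this
      have := H d.classical.var d.classical.stk d.head d.state hlen
      rw [embed, hl]
      exact this)
  refine this.mono_value (le_of_eq ?_)
  rw [sum_map_select hhalt, normSq_scale, Real.sq_sqrt ψ.normSq_nonneg, hrun, List.map_map]
  have hw : N.weight [true] ∘ Cfg.scale (Real.sqrt ψ.normSq) =
      fun d => ψ.normSq * N.weight [true] d :=
    funext fun d => by
      rw [Function.comp_apply, weight_scale, Real.sq_sqrt ψ.normSq_nonneg]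
  have hP : N.outputProb q (p.eval q.length) [true] =
      ((N.runFrom (N.init q) (p.eval q.length)).map (N.weight [true])).sum := by
    rw [outputProb, run_eq_runFrom]; rfl
  have h1 : (N.init q).state.normSq = 1 := normSq_zeroState
  rw [hw, List.sum_map_mul_left, ← hP, h1]
  ring

/-- A bound for the number of steps that a query of length at most `L` takes with `R` votes, if the
machine runs in time `p` and pushes at most `s` symbols in a step. -/
def queryTime (s : ℕ) (p : Polynomial ℕ) (L R : ℕ) : ℕ :=
  R * (2 * L + s * p.eval L + p.eval L + 5) + 2 * L + s * p.eval L + R + 3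

theorem yields_votes {p : Polynomial ℕ} (hp : N.RunsInTime p) {q : List Bool} {L R : ℕ}
    (hq : q.length ≤ L) {A B : ℝ}
    (H : ∀ (b : Bool) r h ψ, (machine M N k).Yields y t
      (cfg (some (.inl (if b then M.ansYes else M.ansNo))) (u, r)
        (Function.update SM M.queryStack []) (fun _ => []) [] len len' clk prod R 0 [] h ψ)
      (ψ.normSq * if b then A else B))
    (j : ℕ) (hj : rep' + j = R) (ht : tally.length ≤ rep')
    (hSN : ∀ s, (SN s).length ≤ L + maxPushes N.tm * p.eval L) :
    (machine M N k).Yields y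
      (t + (j * (2 * L + maxPushes N.tm * p.eval L + p.eval L + 5) +
        2 * L + maxPushes N.tm * p.eval L + R + 3))
      (cfg (some (.inr (.inr .clear))) (u, r)
        (Function.update SM M.queryStack (q.map M.queryAlphabet.symm)) SN [] len len' clk prod j
        rep' tally h ψ)
      (ψ.normSq * voteValue (N.outputProb q (p.eval q.length) [true]) A B j tally) := by
  have hE := eval_mono p hq
  set E := p.eval L
  have hE' : maxPushes N.tm * p.eval q.length ≤ maxPushes N.tm * E := Nat.mul_le_mul_left _ hE
  -- No stack of `N` can be higher than this after a run on a query of length at most `L`; it bounds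
  -- each clearing phase.
  set ℓ := L + maxPushes N.tm * E with hℓ
  induction j generalizing rep' tally SN r h ψ with
  | zero =>
    refine Yields.mono_time (yields_clear (t := t + (L + R) + 1 + 1) (n := ℓ) q (by omega) hSN
      fun r => yields_step rfl fun c hc => ?_) (by omega)
    simp [program, popAux, goAux, ifNone, -List.map_reverse] at hc
    subst hc
    have hfin : ∀ r, (machine M N k).Yields y t
        (cfg (some (.inl (if tally.head? == some true then M.ansYes else M.ansNo))) (u, r)
          (Function.update SM M.queryStack []) (fun _ => []) [] len len' clk prod (rep' + 0) 0 [] h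
          ψ) (ψ.normSq * if tally.head? == some true then A else B) := fun r => by
      rw [hj]
      exact H _ r h ψ
    rw [voteValue]
    -- The buffered query is at most `L` long, while the counter and the tally are at most `R`.
    exact yields_finish (n := L + R) (by simp; omega) (by omega) (by omega) hfin
  | succ j ih =>
    set T := j * (2 * L + maxPushes N.tm * E + E + 5) + 2 * L + maxPushes N.tm * E + R + 3 with hT
    have hvote : ∀ r₂ w SN h ψ,
        (∀ s, (SN s).length ≤ q.length + maxPushes N.tm * p.eval q.length) →
        (machine M N k).Yields y (t + T + 1) (cfg (some (.inr (.inr .vote))) (u, w, r₂)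
          (Function.update SM M.queryStack (q.map M.queryAlphabet.symm)) SN [] len len' clk prod j
          (rep' + 1) tally h ψ)
          (ψ.normSq * if (SN N.tm.k₁).map N.outputAlphabet = [true] then
            voteValue (N.outputProb q (p.eval q.length) [true]) A B j (bump true tally) else
            voteValue (N.outputProb q (p.eval q.length) [true]) A B j (bump false tally)) :=
      fun r₂ w SN h ψ hSN => yields_vote fun r SN' hSN' => by
        have := ih (rep' := rep' + 1) (SN := SN') (r := r) (h := h) (ψ := ψ)
          (tally := bump (decide ((SN N.tm.k₁).map N.outputAlphabet = [true])) tally)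
          (by omega) ((length_bump_le _ _).trans (by omega))
          (fun s => (hSN' s).trans ((hSN s).trans (by omega)))
        split_ifs with hb <;> simpa only [hb, decide_true, decide_false] using this
    refine Yields.mono_time (yields_clear
      (t := p.eval q.length + (t + T + 1) + 1 + q.reverse.length + 1 + 1)
      (n := ℓ) q (by omega) hSN
      fun r => yields_step rfl fun c hc => ?_) (by
        rw [Nat.add_mul j 1, List.length_reverse]; omega)
    simp [program, popAux, pushAux, goAux, ifNone, List.replicate_succ] at hc
    subst hc
    have hload := fun r₂ => yields_run (h := h) (ψ := ψ) hp q (hvote r₂)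
    have := yields_load (buf := q.reverse) (r := (r.1, some true, none)) [] fun r₂ => by
      rw [List.reverse_reverse, List.append_nil]
      exact hload r₂
    have hN : inputStk N.tm ([].map N.inputAlphabet.symm) = fun _ => [] := by
      rw [inputStk_eq_update]; simp
    rw [hN] at this
    -- One run of `N` averages the two continuations with the probabilities of the votes, which is
    -- the recursion of `voteValue`.
    rw [voteValue]
    exact this

theorem queryTime_mono (s : ℕ) (p : Polynomial ℕ) (L : ℕ) {R R' : ℕ} (h : R ≤ R') :
    queryTime s p L R ≤ queryTime s p L R' := by
  unfold queryTime
  gcongr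

theorem outputProb_nonneg (x : List Bool) (T : ℕ) (z : List Bool) : 0 ≤ N.outputProb x T z := by
  refine List.sum_nonneg fun a ha => ?_
  obtain ⟨d, -, rfl⟩ := List.mem_map.mp ha
  exact weight_nonneg z d

/-- Distinct outputs belong to distinct branches and the total weight is 1. This turns acceptance of
no with probability 2/3 into a bound of 1/3 on positive votes. -/
theorem outputProb_add_le_one (x : List Bool) (T : ℕ) {z z' : List Bool} (hz : z ≠ z') :
    N.outputProb x T z + N.outputProb x T z' ≤ 1 := by
  have h1 : ((N.run x T).map fun d => d.state.normSq).sum = 1 := by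
    rw [run_eq_runFrom, sum_normSq_runFrom]
    exact normSq_zeroState
  rw [← h1, outputProb, outputProb, ← List.sum_map_add]
  refine List.sum_le_sum fun d _ => ?_
  by_cases h2 : N.output d = some z
  · have h3 : N.output d ≠ some z' := fun h => hz (Option.some.inj (h2.symm.trans h))
    rw [if_pos h2, if_neg h3, add_zero]
  · rw [if_neg h2, zero_add]
    exact weight_le z' d

theorem yields_cfg_halted (y : List Bool) (t : ℕ) :
    (machine M N k).Yields y t (cfg none (u, r) SM SN buf len len' clk prod rep rep' tally h ψ)
      (if (SM M.tm.k₁).map M.outputAlphabet = y then ψ.normSq else 0) := by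
  have h1 := yields_of_halted (M := machine M N k) (y := y)
    (c := cfg none (u, r) SM SN buf len len' clk prod rep rep' tally h ψ) rfl t
  have h2 : (machine M N k).output (cfg none (u, r) SM SN buf len len' clk prod rep rep' tally h ψ)
      = some ((SM M.tm.k₁).map M.outputAlphabet) := rfl
  refine h1.mono_value (le_of_eq ?_)
  simp only [weight, h2, Option.some.injEq]
  rfl

theorem yields_classical_step {l : M.tm.Λ} (hl : l ≠ M.query)
    (H : ∀ r, (machine M N k).Yields y t
      (cfg ((TM2.stepAux (M.tm.m l) u SM).l.map .inl) ((TM2.stepAux (M.tm.m l) u SM).var, r)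
        (TM2.stepAux (M.tm.m l) u SM).stk SN buf len len' clk prod rep rep' tally h ψ) a) :
    (machine M N k).Yields y (t + 1)
      (cfg (some (.inl l)) (u, r) SM SN buf len len' (clk + 1) prod rep rep' tally h ψ) a := by
  refine yields_step rfl fun c hc => ?_
  have := stepAux_embedStmt (Γ' := Γ M N) (ι := Sum.inl) (e := fun _ a => a)
    (ei := fun _ a => a) (lab := (Sum.inl : _ → Lab M N k))
    (get := (Prod.fst : Var M N → _)) (set := fun v w => (v, w.2)) (H := .halt)
    (fun v => (v, r.1, some true, none))
    (fun S => stk S SN buf (.replicate len true) (.replicate len' true) (.replicate clk true)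
      (.replicate prod true) (.replicate rep true) (.replicate rep' true) tally)
    (fun _ _ => rfl) (fun _ => rfl) (fun _ _ => rfl) (fun _ _ => (List.map_id _).symm)
    (fun _ _ _ => by simp) (M.tm.m l) u SM
  simp [program, popAux, ifNone, hl, List.replicate_succ] at hc
  rw [← hc]
  refine (congrArg (fun c => (machine M N k).Yields y t ⟨c, h, ψ⟩ a) this).mpr ?_
  have h1 := H (r.1, some true, none)
  revert h1
  rcases TM2.stepAux (M.tm.m l) u SM with ⟨_ | l', w, T⟩ <;> exact id

/-- The clock is consulted before every simulated step, so an empty clock forces a halt whatever the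
oracle machine does. -/
theorem yields_timeout {l : M.tm.Λ} :
    (machine M N k).Yields y 1
      (cfg (some (.inl l)) (u, r) SM SN buf len len' 0 prod rep rep' tally h ψ) 0 := by
  refine yields_step (t := 0) rfl fun c hc => ?_
  simp [program, popAux, ifNone] at hc
  subst hc
  exact (yields_cfg_halted (u := u) (r := (r.1, none, none)) (clk := 0) y 0).zero

theorem yields_query_step (H : ∀ r, (machine M N k).Yields y t
      (cfg (some (.inr (.inr .clear))) (u, r) SM SN buf len len' clk prod rep rep' tally h ψ) a) :
    (machine M N k).Yields y (t + 1)
      (cfg (some (.inl M.query)) (u, r) SM SN buf len len' (clk + 1) prod rep rep' tally h ψ)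
      a := by
  refine yields_step rfl fun c hc => ?_
  simp [program, popAux, goAux, ifNone, List.replicate_succ] at hc
  subst hc
  exact H _

theorem yields_simulation_halted {D : DecisionProblem} {R j : ℕ} (hR : 9 ≤ R) {v : ℝ}
    (hv : v = 0 ∨ ∃ τ ≤ j, v = (1 - 9 / (R : ℝ)) ^ τ ∧ M.Solves D y τ ⟨none, u, SM⟩) (t : ℕ) :
    (machine M N k).Yields y t (cfg none (u, r) SM SN buf len len' clk prod rep rep' tally h ψ)
      (ψ.normSq * v) := by
  refine (yields_cfg_halted y t).mono_value ?_
  have hψ := ψ.normSq_nonneg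
  rcases hv with rfl | ⟨τ, -, rfl, hs⟩
  · rw [mul_zero]
    split_ifs
    exacts [hψ, le_rfl]
  · have ho := hs.2
    rw [OracleTM.iterate_step_of_halted (c := ⟨none, u, SM⟩) rfl] at ho
    rw [if_pos (Option.some.inj ho)]
    have hR' : (9 : ℝ) ≤ R := by exact_mod_cast hR
    refine mul_le_of_le_one_right hψ (pow_le_one₀ ?_ (sub_le_self _ (by positivity)))
    rw [sub_nonneg, div_le_one (by linarith)]
    exact hR'

/-- The simulation of an oracle machine `M` with an oracle for `D`: it always halts in time, and it
outputs `y` with high probability if `M` does. -/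
theorem yields_simulation {D : DecisionProblem} {p : Polynomial ℕ} (hp : N.RunsInTime p)
    (hyes : ∀ q ∈ D.yes, 2 / 3 ≤ N.outputProb q (p.eval q.length) [true])
    (hno : ∀ q ∈ D.no, 2 / 3 ≤ N.outputProb q (p.eval q.length) [false])
    {L R : ℕ} (hR : 9 ≤ R) (j : ℕ) (c : M.tm.Cfg)
    (hlen : ∀ s, (c.stk s).length + maxPushes M.tm * j ≤ L) {v : ℝ}
    (hv : v = 0 ∨ ∃ τ ≤ j, v = (1 - 9 / (R : ℝ)) ^ τ ∧ M.Solves D y τ c)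
    (r : N.tm.σ × Option Bool × Option Bool) (h : ℤ) (ψ : QState) :
    (machine M N k).Yields y (j * (queryTime (maxPushes N.tm) p L R + 1) + 1)
      (cfg (c.l.map .inl) (c.var, r) c.stk (fun _ => []) [] len len' j prod R 0 [] h ψ)
      (ψ.normSq * v) := by
  have hR' : (9 : ℝ) ≤ R := by exact_mod_cast hR
  have hδ0 : 0 ≤ 1 - 9 / (R : ℝ) := by
    rw [sub_nonneg, div_le_one (by linarith)]; exact hR'
  have hδ1 : 1 - 9 / (R : ℝ) ≤ 1 := sub_le_self _ (by positivity)
  induction j generalizing c v r h ψ with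
  | zero =>
    obtain ⟨_ | l, u, S⟩ := c
    · exact yields_simulation_halted hR hv _
    · rcases hv with rfl | ⟨τ, hτ, -, hs⟩
      · rw [mul_zero, Nat.zero_mul]
        exact yields_timeout
      · rw [Nat.le_zero.mp hτ] at hs
        cases OracleTM.halted_of_output hs.2
  | succ j ih =>
    obtain ⟨_ | l, u, S⟩ := c
    · exact yields_simulation_halted hR hv _
    have hv' : ∃ v', 0 ≤ v' ∧ v = (1 - 9 / (R : ℝ)) * v' ∧ (v' = 0 ∨
        (∃ τ ≤ j, v' = (1 - 9 / (R : ℝ)) ^ τ ∧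
          M.Solves D y τ (M.step D.yes ⟨some l, u, S⟩)) ∧
        (l = M.query → (S M.queryStack).map M.queryAlphabet ∈ D.yes ∪ D.no)) := by
      rcases hv with rfl | ⟨_ | τ, hτ, rfl, hs⟩
      · exact ⟨0, le_rfl, by rw [mul_zero], Or.inl rfl⟩
      · cases OracleTM.halted_of_output hs.2
      · refine ⟨_, pow_nonneg hδ0 τ, by rw [pow_succ'],
          Or.inr ⟨⟨τ, by omega, rfl, hs.step⟩, fun hq => ?_⟩⟩
        exact hs.1 0 (congrArg some hq)
    obtain ⟨v', hv0, rfl, hv'⟩ := hv'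
    set Tq := queryTime (maxPushes N.tm) p L R with hTq
    by_cases hl : l = M.query
    · subst hl
      obtain ⟨q, hq⟩ : ∃ q, q = (S M.queryStack).map M.queryAlphabet := ⟨_, rfl⟩
      have hS : S = Function.update S M.queryStack (q.map M.queryAlphabet.symm) := by
        simp [hq]
      have hqL : q.length ≤ L := by
        have := hlen M.queryStack
        rw [hq, List.length_map]
        exact le_trans (Nat.le_add_right _ _) this
      rw [← hq] at hv'
      have hP0 := outputProb_nonneg (N := N) q (p.eval q.length) [true]
      have hsum := outputProb_add_le_one (N := N) q (p.eval q.length)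
        (by decide : [true] ≠ [false])
      have hP1 : N.outputProb q (p.eval q.length) [true] ≤ 1 := by
        linarith [outputProb_nonneg (N := N) q (p.eval q.length) [false]]
      -- `A` and `B` are the values of continuing after the answers yes and no; a wrong answer is
      -- worth 0, so nothing need be known about what follows it.
      have key : ∀ A B : ℝ, (∀ b : Bool, (if b then A else B) = 0 ∨
          (∃ τ ≤ j, (if b then A else B) = (1 - 9 / (R : ℝ)) ^ τ ∧
            M.Solves D y τ ⟨some (if b then M.ansYes else M.ansNo), u,
              Function.update S M.queryStack []⟩)) →
          (1 - 9 / (R : ℝ)) * v' ≤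
            voteValue (N.outputProb q (p.eval q.length) [true]) A B R [] →
          (machine M N k).Yields y ((j + 1) * (Tq + 1) + 1)
            (cfg (some (.inl M.query)) (u, r) S (fun _ => []) [] len len' (j + 1) prod R 0 [] h ψ)
            (ψ.normSq * ((1 - 9 / (R : ℝ)) * v')) := fun A B hAB hle => by
        have hlen' : ∀ s, (Function.update S M.queryStack [] s).length + maxPushes M.tm * j ≤ L :=
          fun s => by
            have h1 : (Function.update S M.queryStack [] s).length ≤ (S s).length := by
              by_cases hs : s = M.queryStack
              · subst hs; simp
              · simp [hs]
            have h2 : (S s).length + maxPushes M.tm * (j + 1) ≤ L := hlen s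
            rw [Nat.mul_succ] at h2
            omega
        have h1 := fun r => yields_votes (M := M) (N := N) (k := k) (y := y) (SM := S) (u := u)
          (len := len) (len' := len') (clk := j) (prod := prod) (A := A) (B := B)
          (t := j * (Tq + 1) + 1) (R := R) (rep' := 0) (tally := []) (SN := fun _ => []) (r := r) (h := h)
          (ψ := ψ) hp hqL (fun b r h ψ =>
            ih (v := if b then A else B) ⟨some (if b then M.ansYes else M.ansNo), u, Function.update S M.queryStack []⟩
              hlen' (hAB b) r h ψ) R (by omega) (by simp) (by simp)
        rw [← hS] at h1
        have h2 := yields_query_step (r := r) h1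
        refine h2.mono ?_
          (mul_le_mul_of_nonneg_left hle ψ.normSq_nonneg)
        rw [Nat.add_mul j 1, hTq, queryTime]
        omega
      have hstep := OracleTM.step_query D.yes u S
      rw [← hq] at hstep
      rcases hv' with rfl | ⟨hτ, hmem⟩
      · refine key 0 0 (fun b => Or.inl (by simp)) ?_
        rw [mul_zero]
        exact voteValue_nonneg hP0 hP1 le_rfl le_rfl _ _
      · rw [hstep] at hτ
        by_cases hyq : q ∈ D.yes
        · rw [if_pos hyq] at hτ
          refine key v' 0 (fun b => ?_)
            (voteValue_of_two_thirds_le (by omega) (hyes q hyq) hP1 hv0)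
          cases b
          · exact Or.inl rfl
          · exact Or.inr hτ
        · rw [if_neg hyq] at hτ
          refine key 0 v' (fun b => ?_)
            (voteValue_of_le_third (by omega) hP0
              (by linarith [hno q ((hmem rfl).resolve_left hyq)]) hv0)
          cases b
          · exact Or.inr hτ
          · exact Or.inl rfl
    · have hstep := OracleTM.step_classical (O := D.yes) hl u S
      have h1 := yields_classical_step (N := N) (k := k) hl (u := u) (SM := S) (r := r) fun r =>
        ih (v := v') (TM2.stepAux (M.tm.m l) u S) (fun s => by
          have h1 := length_stepAux_le (M.tm.m l) u S s
          have h2 := pushes_le_maxPushes M.tm l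
          have h3 : (S s).length + maxPushes M.tm * (j + 1) ≤ L := hlen s
          rw [Nat.mul_succ] at h3
          exact le_trans (Nat.add_le_add_right h1 _) (by omega))
          (hv'.imp_right fun h => by
            have := h.1
            rwa [hstep] at this) r h ψ
      -- A classical step loses no probability; its factor `1 - 9 / R` is given away to keep the
      -- bound uniform.
      refine h1.mono ?_
        (mul_le_mul_of_nonneg_left (mul_le_of_le_one_left hv0 hδ1) ψ.normSq_nonneg)
      rw [Nat.add_mul j 1]
      omega

/-! ### The complete run of the simulator and its polynomial time bound. -/

theorem init_machine (x : List Bool) :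
    (machine M N k).init x = cfg (some (.inr (.inr .read)))
      (M.tm.initialState, N.tm.initialState, none, none)
      (inputStk M.tm (x.map M.inputAlphabet.symm)) (fun _ => []) [] 0 0 0 0 0 0 [] 0
      QState.zero := by
  have : (initList (control M N k) (x.map M.inputAlphabet.symm)).stk =
      stk (inputStk M.tm (x.map M.inputAlphabet.symm)) (fun _ => []) [] [] [] [] [] [] [] [] := by
    refine (inputStk_eq_update (control M N k) _).trans ?_
    rw [inputStk_eq_update, ← update_inl]
    refine congrArg (fun S => Function.update S (Sum.inl M.tm.k₀) _) ?_
    funext s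
    rcases s with s | s | (_ | _) <;> rfl
  exact congrArg (fun S => (⟨⟨some (.inr (.inr .read)),
    (M.tm.initialState, N.tm.initialState, none, none), S⟩, 0, QState.zero⟩ :
      (machine M N k).Cfg)) this

/-- A bound for the running time of the simulator, if the oracle machine pushes at most `s` symbols
and `N` pushes at most `s'` symbols in a step. -/
def runningTime (s s' : ℕ) (p : Polynomial ℕ) (k : ℕ) : Polynomial ℕ :=
  let C : Polynomial ℕ := (.X + 2) ^ k
  let L : Polynomial ℕ := .X + .C s * C
  let R : Polynomial ℕ := 1 + k * C
  C * (R * (2 * L + .C s' * p.comp L + p.comp L + 5) + 2 * L + .C s' * p.comp L + R + 3 + 1) + 1 +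
    k * (C * (2 * (.X + 2) + 4) + 2) + 1 + .X + 1 + .X + 1

theorem eval_runningTime (s s' : ℕ) (p : Polynomial ℕ) (k n : ℕ) :
    (runningTime s s' p k).eval n =
      (n + 2) ^ k * (queryTime s' p (n + s * (n + 2) ^ k) (1 + k * (n + 2) ^ k) + 1) + 1 +
        k * ((n + 2) ^ k * (2 * (n + 2) + 4) + 2) + 1 + n + 1 + n + 1 := by
  simp [runningTime, queryTime]

theorem yields_init {D : DecisionProblem} {p : Polynomial ℕ} (hp : N.RunsInTime p)
    (hyes : ∀ q ∈ D.yes, 2 / 3 ≤ N.outputProb q (p.eval q.length) [true])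
    (hno : ∀ q ∈ D.no, 2 / 3 ≤ N.outputProb q (p.eval q.length) [false])
    {x : List Bool} {τ : ℕ} (hτ : 27 * τ + 9 ≤ (x.length + 2) ^ k) {v : ℝ}
    (hv : v = 0 ∨ v = 2 / 3 ∧ M.Solves D y τ (initList M.tm (x.map M.inputAlphabet.symm))) :
    (machine M N k).Yields y
      ((runningTime (maxPushes M.tm) (maxPushes N.tm) p k).eval x.length)
      ((machine M N k).init x) v := by
  rw [init_machine, eval_runningTime]
  set n := x.length
  set C := (n + 2) ^ k with hC
  have hsim : ∀ r R, C ≤ R → R ≤ 1 + k * C → (machine M N k).Yields y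
      (C * (queryTime (maxPushes N.tm) p (n + maxPushes M.tm * C) (1 + k * C) + 1) + 1)
      (cfg (some (.inl M.tm.main)) (M.tm.initialState, r)
        (inputStk M.tm (x.map M.inputAlphabet.symm)) (fun _ => []) [] (n + 2) 0 C 0 R 0 [] 0
        QState.zero) v := fun r R hCR hR => by
    have hlen : ∀ s, (inputStk M.tm (x.map M.inputAlphabet.symm) s).length + maxPushes M.tm * C ≤
        n + maxPushes M.tm * C := fun s => by
      have := length_inputStk_le M.tm (x.map M.inputAlphabet.symm) s
      rw [List.length_map] at this
      exact Nat.add_le_add_right this _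
    obtain ⟨v', hle, hv'⟩ : ∃ v', v ≤ v' ∧ (v' = 0 ∨ ∃ τ ≤ C, v' = (1 - 9 / (R : ℝ)) ^ τ ∧
        M.Solves D y τ (initList M.tm (x.map M.inputAlphabet.symm))) := by
      rcases hv with rfl | ⟨rfl, hs⟩
      · exact ⟨0, le_rfl, Or.inl rfl⟩
      · refine ⟨_, ?_, Or.inr ⟨τ, by omega, rfl, hs⟩⟩
        have hR0 : (27 * τ + 9 : ℝ) ≤ R := by exact_mod_cast hτ.trans hCR
        have hτ0 : (0 : ℝ) ≤ τ := Nat.cast_nonneg τ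
        have hR1 : (0 : ℝ) < R := by linarith
        have h9 : 9 / (R : ℝ) ≤ 1 := by rw [div_le_one hR1]; linarith
        -- Bernoulli's inequality: the total loss is at most `9 * τ / R`, which is at most 1/3 since
        -- `27 * τ ≤ R`. The summand 9 in `hτ` makes the base nonnegative also for `τ = 0`.
        have := one_add_mul_le_pow (a := -(9 / (R : ℝ))) (by linarith) τ
        rw [← sub_eq_add_neg] at this
        refine le_trans ?_ this
        have h27 : (τ : ℝ) * (9 / R) ≤ 1 / 3 := by
          rw [← mul_div_assoc, div_le_div_iff₀ hR1 (by norm_num)]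
          linarith
        linarith
    have := yields_simulation (k := k) (len := n + 2) (len' := 0) (prod := 0) hp hyes hno
      (by omega : 9 ≤ R) C (initList M.tm (x.map M.inputAlphabet.symm)) hlen hv' r 0 QState.zero
    rw [normSq_zeroState, one_mul] at this
    refine this.mono (Nat.add_le_add_right (Nat.mul_le_mul_left _ (Nat.add_le_add_right
      (queryTime_mono _ _ _ hR) 1)) 1) hle
  refine yields_read x fun r => ?_
  rw [List.append_nil]
  refine Yields.mono_time (yields_restore [] fun r => ?_) (by rw [List.length_reverse])
  rw [List.reverse_reverse, List.append_nil]
  have := yields_power (k := k) (M := M) (N := N) (clk := 1) (rep := 1) (m := n + 2) (by omega) k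
    (Fin.last k) rfl le_rfl (y := y) (r := r) (u := M.tm.initialState)
    (SM := inputStk M.tm (x.map M.inputAlphabet.symm)) (SN := fun _ => []) (buf := []) (rep' := 0)
    (tally := []) (h := 0) (ψ := QState.zero) fun r R h1 h2 => by
      rw [Nat.one_mul] at h1 h2 ⊢
      exact hsim r R h1 h2
  rw [Nat.one_mul] at this
  exact this

end Simulator

/-! ### From a reduction to a pseudo-deterministic algorithm. -/

open Simulator in
theorem SearchProblem.hasPseudoDetQuantumPolyTime_of_pReducible {R : SearchProblem}
    {D : DecisionProblem} (hD : D.InBQP) (hR : R.PReducible D) :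
    R.HasPseudoDetQuantumPolyTime := by
  obtain ⟨N, p, hp, hyes, hno⟩ := hD
  obtain ⟨M, pM, hM⟩ := hR
  obtain ⟨k, hk⟩ := exists_eval_le_pow (27 * pM + 9)
  have hk' : ∀ n, 27 * pM.eval n + 9 ≤ (n + 2) ^ k := fun n => by simpa using hk n
  -- The oracle `D.yes` is fixed and the machine deterministic, so the solution depends on `x`
  -- alone; this is the source of pseudo-determinism.
  have hf : ∀ x, ∃ y, x ∈ R.dom → (x, y) ∈ R.rel ∧
      M.Solves D y (pM.eval x.length) (initList M.tm (x.map M.inputAlphabet.symm)) := fun x => by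
    by_cases hx : x ∈ R.dom
    · obtain ⟨h1, y, h2, h3⟩ := hM x hx
      exact ⟨y, fun _ => ⟨h3, h1, h2⟩⟩
    · exact ⟨[], fun h => (hx h).elim⟩
  choose f hf using hf
  refine ⟨machine M N k, runningTime (maxPushes M.tm) (maxPushes N.tm) p k,
    QuantumTM.runsInTime_of_yields fun x =>
      -- Value zero requires nothing of `x`, so the time bound also holds on inputs outside the
      -- domain.
      ⟨[], 0, yields_init hp hyes hno (hk' x.length) (Or.inl rfl)⟩, f, fun x hx => ?_⟩
  exact ⟨(hf x hx).1,
    (yields_init hp hyes hno (hk' x.length) (Or.inr ⟨rfl, (hf x hx).2⟩)).outputProb_le⟩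

end PseudoDet
end

theorem mainTheorem9 (R : PseudoDet.SearchProblem) :
    (R.dom = Set.univ →
      (R.HasPseudoDetQuantumPolyTime ↔
        ∃ L : Set (List Bool), (PseudoDet.DecisionProblem.ofLanguage L).InBQP ∧
          R.PReducible (PseudoDet.DecisionProblem.ofLanguage L))) ∧
    (R.HasPseudoDetQuantumPolyTime ↔
      ∃ D : PseudoDet.DecisionProblem, D.InBQP ∧ R.PReducible D) := by
  refine ⟨fun hdom => ⟨fun h => ?_, fun ⟨L, hL, hR⟩ =>
    R.hasPseudoDetQuantumPolyTime_of_pReducible hL hR⟩, fun h => ?_, fun ⟨D, hD, hR⟩ =>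
    R.hasPseudoDetQuantumPolyTime_of_pReducible hD hR⟩
  · obtain ⟨f, hf⟩ := h.exists_bitProblem
    rw [hdom, PseudoDet.bitProblem_univ] at hf
    exact ⟨_, hf⟩
  · obtain ⟨f, hf⟩ := h.exists_bitProblem
    exact ⟨_, hf⟩
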